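/- For $n \ge 0$ let $\mathcal{P}(n)$ be the set of partitions of $n$ and $p(n) = |\mathcal{P}(n)|$. For $\lambda \in \mathcal{P}(n)$ let $d_\lambda$ be the dimension of the irreducible complex representation $\pi_\lambda$ of the symmetric group $S_n$ attached to $\lambda$, realised as the Specht module $\mathbb{C}[S_n]\,c_\lambda$, where $c_\lambda$ is a Young symmetrizer of shape $\lambda$. Let $m_n$ be the maximum of the dimensions of the irreducible complex representations of $S_n$. Fix a real number $A$ with $0 < A < 1$ and define $C_n$ by \[ C_n\, p(n) = \bigl|\{\lambda \in \mathcal{P}(n) \;:\; A\, m_n \le d_\lambda \le m_n\}\bigr| . \] Then $0 < C_n \le 1$ for every $n$, and $C_n \to 0$ as $n \to \infty$. That is, the proportion of partitions $\lambda$ of $n$ with $A\, m_n \le d_\lambda \le m_n$ tends to $0$. -/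

import Mathlib

open Filter Topology

namespace SymGroupDim

/-- The parts of a partition, listed in weakly decreasing order. -/
def partsList {n : ℕ} (lam : n.Partition) : List ℕ :=
  lam.parts.sort (fun a b => b ≤ a)

theorem partsList_sortedGE {n : ℕ} (lam : n.Partition) : (partsList lam).SortedGE :=
  (Multiset.pairwise_sort lam.parts (fun a b => b ≤ a)).sortedGE

/-- The Young diagram of a partition: row `i` (counted from `0`) has `λ_{i+1}` cells. -/
def diagram {n : ℕ} (lam : n.Partition) : YoungDiagram :=
  YoungDiagram.ofRowLens (partsList lam) (partsList_sortedGE lam)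

theorem card_cellsOfRowLens (w : List ℕ) :
    (YoungDiagram.cellsOfRowLens w).card = w.sum := by
  induction w with
  | nil => simp [YoungDiagram.cellsOfRowLens]
  | cons a l ih =>
    rw [YoungDiagram.cellsOfRowLens, Finset.card_union_of_disjoint]
    · simp [ih]
    · rw [Finset.disjoint_left]
      rintro ⟨i, j⟩ h1 h2
      simp at h1 h2
      omega

theorem card_diagram {n : ℕ} (lam : n.Partition) : (diagram lam).cells.card = n := by
  have h : ((partsList lam : List ℕ) : Multiset ℕ) = lam.parts := Multiset.sort_eq _ _
  calc (diagram lam).cells.card = (partsList lam).sum := card_cellsOfRowLens _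
    _ = lam.parts.sum := by rw [← h, Multiset.sum_coe]
    _ = n := lam.parts_sum

/-- A (bijective) Young tableau of shape `λ`: a labelling of the cells by `Fin n`. A cell is
`(row, column)`. -/
abbrev Tableau {n : ℕ} (lam : n.Partition) : Type :=
  Fin n ≃ (diagram lam).cells

/-- A tableau of shape `λ`, fixed once and for all. A different choice conjugates the row and
column groups, so that it gives an isomorphic representation. -/
noncomputable def tableau {n : ℕ} (lam : n.Partition) : Tableau lam :=
  ((diagram lam).cells.equivFinOfCardEq (card_diagram lam)).symm

/-- The row group of a tableau: the permutations which map every row to itself. -/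
def rowGroup {n : ℕ} {lam : n.Partition} (T : Tableau lam) : Finset (Equiv.Perm (Fin n)) :=
  {g | ∀ x, (T (g x)).1.1 = (T x).1.1}

/-- The column group of a tableau: the permutations which map every column to itself. -/
def colGroup {n : ℕ} {lam : n.Partition} (T : Tableau lam) : Finset (Equiv.Perm (Fin n)) :=
  {g | ∀ x, (T (g x)).1.2 = (T x).1.2}

/-- The Young symmetrizer `(∑_{p ∈ R(T)} p) (∑_{q ∈ C(T)} sgn(q) q)` in the group algebra
`ℂ[S_n]`. -/
noncomputable def youngSymmetrizer {n : ℕ} {lam : n.Partition} (T : Tableau lam) :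
    MonoidAlgebra ℂ (Equiv.Perm (Fin n)) :=
  (∑ p ∈ rowGroup T, MonoidAlgebra.single p (1 : ℂ)) *
    (∑ q ∈ colGroup T, MonoidAlgebra.single q ((Equiv.Perm.sign q : ℤ) : ℂ))

/-- The Specht module of `λ`: the left ideal of `ℂ[S_n]` generated by the Young symmetrizer. -/
noncomputable def spechtModule {n : ℕ} (lam : n.Partition) :
    Submodule (MonoidAlgebra ℂ (Equiv.Perm (Fin n))) (MonoidAlgebra ℂ (Equiv.Perm (Fin n))) :=
  Submodule.span _ {youngSymmetrizer (tableau lam)}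

/-- The representation `π_λ` of `S_n` on the Specht module, by left multiplication. -/
noncomputable def spechtRep {n : ℕ} (lam : n.Partition) :
    Representation ℂ (Equiv.Perm (Fin n)) (spechtModule lam) :=
  Representation.ofModule' (spechtModule lam)

theorem coe_spechtRep_apply {n : ℕ} (lam : n.Partition) (g : Equiv.Perm (Fin n))
    (v : spechtModule lam) :
    (spechtRep lam g v : MonoidAlgebra ℂ (Equiv.Perm (Fin n))) =
      MonoidAlgebra.single g (1 : ℂ) * v := by
  simp [spechtRep, Representation.ofModule']

/-- `d_λ`, the dimension of the representation `π_λ`. -/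
noncomputable def dimSpecht {n : ℕ} (lam : n.Partition) : ℕ :=
  Module.finrank ℂ (spechtModule lam)

/-- The set of dimensions of the irreducible complex representations of `S_n`. -/
def irrepDims (n : ℕ) : Set ℕ :=
  {d | ∃ (V : Type) (_ : AddCommGroup V) (_ : Module ℂ V)
    (ρ : Representation ℂ (Equiv.Perm (Fin n)) V),
    ρ.IsIrreducible ∧ Module.finrank ℂ V = d}

/-- `m_n`, the largest dimension of an irreducible complex representation of `S_n`. -/
noncomputable def maxDim (n : ℕ) : ℕ :=
  sSup (irrepDims n)

theorem irrepDims_nonempty (n : ℕ) : (irrepDims n).Nonempty := by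
  refine ⟨1, ℂ, inferInstance, inferInstance, Representation.trivial ℂ _ ℂ, ?_, by simp⟩
  refine { exists_pair_ne := ⟨⊥, ⊤, fun h => ?_⟩, eq_bot_or_eq_top := fun W => ?_ }
  · have h' : (⊥ : Submodule ℂ ℂ) = ⊤ := congrArg Subrepresentation.toSubmodule h
    exact bot_ne_top h'
  · rcases eq_bot_or_eq_top W.toSubmodule with h | h
    · exact Or.inl (Subrepresentation.toSubmodule_injective h)
    · exact Or.inr (Subrepresentation.toSubmodule_injective h)

theorem irrepDims_bddAbove (n : ℕ) : BddAbove (irrepDims n) := by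
  refine ⟨n.factorial, ?_⟩
  rintro d ⟨V, _, _, ρ, hρ, rfl⟩
  have hs := (Representation.irreducible_iff_isSimpleModule_asModule ρ).mp hρ
  have := hs.nontrivial
  obtain ⟨v, hv⟩ := exists_ne (0 : ρ.asModule)
  have hsurj := IsSimpleModule.toSpanSingleton_surjective
    (MonoidAlgebra ℂ (Equiv.Perm (Fin n))) hv
  have key := LinearMap.finrank_le_finrank_of_surjective
    (f := (LinearMap.toSpanSingleton (MonoidAlgebra ℂ (Equiv.Perm (Fin n)))
      ρ.asModule v).restrictScalars ℂ) hsurj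
  rw [← ρ.asModuleEquiv.finrank_eq]
  refine key.trans (le_of_eq ?_)
  rw [(MonoidAlgebra.coeffLinearEquiv ℂ).finrank_eq]
  simp [Fintype.card_perm]

/-- The maximum which defines `m_n` is attained. -/
theorem maxDim_isGreatest (n : ℕ) : IsGreatest (irrepDims n) (maxDim n) :=
  ⟨Nat.sSup_mem (irrepDims_nonempty n) (irrepDims_bddAbove n),
    fun _ hd => le_csSup (irrepDims_bddAbove n) hd⟩

/-- `C_n`, the proportion of the partitions `λ` of `n` with `A m_n ≤ d_λ ≤ m_n`. -/
noncomputable def proportion (A : ℝ) (n : ℕ) : ℝ :=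
  (Nat.card {lam : n.Partition //
      A * (maxDim n : ℝ) ≤ (dimSpecht lam : ℝ) ∧ dimSpecht lam ≤ maxDim n} : ℝ) /
    (Fintype.card n.Partition : ℝ)

end SymGroupDim

/-! Let I be the number of g in S_n with g² = 1. Since Σ d_λ² = n! (`sum_dimSpecht_sq`) and Σ d_λ =
I (`sum_dimSpecht`), n! ≤ m_n I. The bound I ≤ √(n!) e^{√n} (`involutionCount_le`) then gives m_n ≥
√(n!) e^{-√n}. Every λ counted by C_n p(n) contributes at least (A m_n)² to Σ d_λ² = n!, so C_n p(n)
≤ A⁻² e^{2√n} (`proportion_mul_le`). Partitions are more numerous: p(n) is at least 2^d e^{4d} over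
a polynomial in d, with d about √n/2 (`two_pow_mul_exp_le_card_partition`). Here e^{4d} matches
e^{2√n} up to a constant, and 2^d is the gain that forces C_n → 0.

The two dimension sums are computed in the group algebra. A Young symmetrizer ab is replaced by a
multiple of aba: a primitive idempotent e_λ with coefficients invariant under g ↦ g⁻¹, whose left
ideal has the same dimension. Different shapes give orthogonal idempotents by dominance, and they
are numerous enough to fill the centre, so 1 = Σ_λ (d_λ/n!) Σ_h h e_λ h⁻¹. The coefficient at the
identity gives Σ d_λ². Multiplying first by Σ h², which acts on e_λ as n!/d_λ (Frobenius–Schur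
indicator 1), gives Σ d_λ. The same expansion bounds the dimension of every irreducible by some d_λ,
so a Specht module attains m_n and C_n > 0. -/

namespace GroupAlgebra

/-! ### Symmetric primitive idempotents in the group algebra of a finite group. -/

open MonoidAlgebra

variable {G : Type} [Group G] [Fintype G]

theorem sum_coeff_smul_of (x : MonoidAlgebra ℂ G) : ∑ g, x.coeff g • of ℂ G g = x := by
  classical
  ext h
  simp [coeff_sum]

omit [Fintype G] in
theorem coeff_of_mul (h g : G) (x : MonoidAlgebra ℂ G) :
    (of ℂ G h * x).coeff g = x.coeff (h⁻¹ * g) := by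
  simp [of_apply, coeff_single_mul_apply]

omit [Fintype G] in
theorem coeff_mul_of (h g : G) (x : MonoidAlgebra ℂ G) :
    (x * of ℂ G h).coeff g = x.coeff (g * h⁻¹) := by
  simp [of_apply, coeff_mul_single_apply]

theorem coeff_mul_eq_sum (x y : MonoidAlgebra ℂ G) (g : G) :
    (x * y).coeff g = ∑ h, x.coeff h * y.coeff (h⁻¹ * g) := by
  conv_lhs => rw [← sum_coeff_smul_of x]
  simp [Finset.sum_mul, coeff_sum, -of_apply, coeff_of_mul]

/-- In the basis of group elements every diagonal entry is the coefficient of g in gy, which is y at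
1. -/
theorem trace_mulRight (y : MonoidAlgebra ℂ G) :
    LinearMap.trace ℂ (MonoidAlgebra ℂ G) (LinearMap.mulRight ℂ y) =
      Fintype.card G * y.coeff 1 := by
  classical
  let b : Module.Basis G ℂ (MonoidAlgebra ℂ G) := .ofRepr (coeffLinearEquiv ℂ)
  have hb : ∀ g, b g = of ℂ G g := fun g => rfl
  rw [LinearMap.trace_eq_matrix_trace ℂ b, Matrix.trace]
  have : ∀ g, Matrix.diag (LinearMap.toMatrix b b (LinearMap.mulRight ℂ y)) g = y.coeff 1 := by
    intro g
    rw [Matrix.diag_apply, LinearMap.toMatrix_apply, hb, LinearMap.mulRight_apply]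
    change (of ℂ G g * y).coeff g = _
    rw [coeff_of_mul, inv_mul_cancel]
  rw [Finset.sum_congr rfl fun g _ => this g]
  simp

instance : FiniteDimensional ℂ (MonoidAlgebra ℂ G) :=
  Module.Finite.equiv (coeffLinearEquiv (S := ℂ) (M := G) ℂ).symm

theorem card_cast_ne_zero : (Fintype.card G : ℂ) ≠ 0 := by
  exact_mod_cast Fintype.card_ne_zero

/-- Right multiplication by `e` projects onto the left ideal, so its trace is the dimension. -/
theorem finrank_span_of_idempotent {e : MonoidAlgebra ℂ G} (he : e * e = e) :
    (Module.finrank ℂ (Submodule.span (MonoidAlgebra ℂ G) {e}) : ℂ) =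
      Fintype.card G * e.coeff 1 := by
  rw [← trace_mulRight]
  have hp : LinearMap.IsProj
      ((Submodule.span (MonoidAlgebra ℂ G) {e}).restrictScalars ℂ) (LinearMap.mulRight ℂ e) := by
    refine ⟨fun x => ?_, fun x hx => ?_⟩
    · exact Submodule.mem_span_singleton.2 ⟨x, rfl⟩
    · obtain ⟨a, rfl⟩ := Submodule.mem_span_singleton.1 hx
      simp [mul_assoc, he]
  rw [hp.trace]
  rfl

/-- A nonzero idempotent of the group algebra which spans its corner over the scalars and whose
coefficients are invariant under inversion. -/
structure IsSymmPrimitive (e : MonoidAlgebra ℂ G) : Prop where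
  ne_zero : e ≠ 0
  mul_self : e * e = e
  corner : ∀ x, ∃ α : ℂ, e * x * e = α • e
  symm : ∀ g, e.coeff g⁻¹ = e.coeff g

/-- The dimension of the left ideal generated by `e`. -/
noncomputable def idealDim (e : MonoidAlgebra ℂ G) : ℕ :=
  Module.finrank ℂ (Submodule.span (MonoidAlgebra ℂ G) {e})

/-- The sum of the conjugates of `e`. -/
noncomputable def conjSum (e : MonoidAlgebra ℂ G) : MonoidAlgebra ℂ G :=
  ∑ h, of ℂ G h * e * of ℂ G h⁻¹

theorem conjSum_comm (e x : MonoidAlgebra ℂ G) : conjSum e * x = x * conjSum e := by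
  rw [← sum_coeff_smul_of x, Finset.mul_sum, Finset.sum_mul]
  refine Finset.sum_congr rfl fun g _ => ?_
  rw [mul_smul_comm, smul_mul_assoc]
  congr 1
  rw [conjSum, Finset.sum_mul, Finset.mul_sum]
  refine (Fintype.sum_equiv (Equiv.mulLeft g) _ _ fun h => ?_).symm
  rw [Equiv.coe_mulLeft, mul_inv_rev, map_mul, map_mul]
  simp only [mul_assoc]
  rw [← map_mul _ g⁻¹ g, inv_mul_cancel, map_one, mul_one]

theorem coeff_conjSum_one (e : MonoidAlgebra ℂ G) :
    (conjSum e).coeff 1 = Fintype.card G * e.coeff 1 := by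
  simp [conjSum, coeff_sum, -of_apply, coeff_of_mul, coeff_mul_of]

/-- The sum of the squares of the group elements. -/
noncomputable def squareSum (G : Type) [Group G] [Fintype G] : MonoidAlgebra ℂ G :=
  ∑ h : G, of ℂ G (h * h)

theorem squareSum_comm (x : MonoidAlgebra ℂ G) : squareSum G * x = x * squareSum G := by
  rw [← sum_coeff_smul_of x, Finset.mul_sum, Finset.sum_mul]
  refine Finset.sum_congr rfl fun g _ => ?_
  rw [mul_smul_comm, smul_mul_assoc]
  congr 1
  rw [squareSum, Finset.sum_mul, Finset.mul_sum]
  refine (Fintype.sum_equiv (MulAut.conj g).toEquiv _ _ fun h => ?_).symm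
  rw [← map_mul, ← map_mul]
  congr 1
  simp [mul_assoc]

theorem coeff_squareSum_one [DecidableEq G] :
    (squareSum G).coeff 1 = (Finset.univ.filter fun h : G => h * h = 1).card := by
  simp [squareSum, coeff_sum, Finsupp.single_apply]

namespace IsSymmPrimitive

variable {e : MonoidAlgebra ℂ G} (he : IsSymmPrimitive e)
include he

theorem idealDim_eq : (idealDim e : ℂ) = Fintype.card G * e.coeff 1 :=
  finrank_span_of_idempotent he.mul_self

theorem idealDim_pos : 0 < idealDim e := by
  have : Nontrivial (Submodule.span (MonoidAlgebra ℂ G) {e}) := by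
    refine ⟨⟨e, Submodule.mem_span_singleton_self e⟩, 0, fun h => he.ne_zero ?_⟩
    exact congrArg Subtype.val h
  have : FiniteDimensional ℂ (Submodule.span (MonoidAlgebra ℂ G) {e}) :=
    inferInstanceAs (FiniteDimensional ℂ
      ((Submodule.span (MonoidAlgebra ℂ G) {e}).restrictScalars ℂ))
  exact Module.finrank_pos

theorem coeff_one_ne : e.coeff 1 ≠ 0 := by
  intro h
  have := he.idealDim_eq
  rw [h, mul_zero] at this
  exact he.idealDim_pos.ne' (by exact_mod_cast this)

/-- The scalar is read off at the identity. The coefficient at 1 is invariant under cyclic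
permutation of factors, so e h e and e e h = e h agree there. -/
theorem mul_of_mul (h : G) : e * of ℂ G h * e = (e.coeff h⁻¹ / e.coeff 1) • e := by
  obtain ⟨α, hα⟩ := he.corner (of ℂ G h)
  have h1 : (e * of ℂ G h * e).coeff 1 = e.coeff h⁻¹ := by
    have : (e * of ℂ G h * e).coeff 1 = (e * e * of ℂ G h).coeff 1 := by
      rw [mul_assoc, coeff_mul_eq_sum, mul_assoc, coeff_mul_eq_sum]
      simp only [coeff_of_mul, coeff_mul_of, mul_one]
      refine Fintype.sum_equiv ((Equiv.inv G).trans (Equiv.mulLeft h⁻¹)) _ _ fun g => ?_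
      simp [mul_comm]
    rw [this, he.mul_self, coeff_mul_of, one_mul]
  rw [hα] at h1 ⊢
  rw [← h1]
  simp [he.coeff_one_ne]

/-- The scalar by which `conjSum e` acts on `e`. -/
theorem mul_conjSum : e * conjSum e = ((Fintype.card G : ℂ) / idealDim e) • e := by
  have h1 : e * conjSum e = ∑ h : G, (e * of ℂ G h * e) * (of ℂ G h⁻¹ * e) := by
    calc e * conjSum e = e * (conjSum e * e) := by
          rw [conjSum_comm, ← mul_assoc, he.mul_self]
      _ = _ := by
          rw [conjSum, Finset.sum_mul, Finset.mul_sum]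
          simp only [mul_assoc]
  -- This is e² = e compared at the identity.
  have h2 : ∑ h, e.coeff h⁻¹ * e.coeff h = e.coeff 1 := by
    conv_rhs => rw [← he.mul_self, coeff_mul_eq_sum]
    simp [he.symm]
  have h3 : ∀ h : G, (e * of ℂ G h * e) * (of ℂ G h⁻¹ * e) =
      ((e.coeff h⁻¹ * e.coeff h) / (e.coeff 1 * e.coeff 1)) • e := by
    intro h
    rw [he.mul_of_mul, smul_mul_assoc, ← mul_assoc, he.mul_of_mul, inv_inv, smul_smul]
    congr 1
    field_simp
  rw [h1, Finset.sum_congr rfl fun h _ => h3 h, ← Finset.sum_smul, ← Finset.sum_div, h2,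
    he.idealDim_eq]
  congr 1
  have := he.coeff_one_ne
  have := card_cast_ne_zero (G := G)
  field_simp

/-- Since hgh = (hg)² g⁻¹, summing hgh over h gives the sum of squares times g⁻¹. Invariance of the
coefficients of `e` under inversion then turns g⁻¹ back into g. -/
theorem squareSum_mul : squareSum G * e = ∑ h : G, of ℂ G h * e * of ℂ G h := by
  have h1 : ∀ h : G, of ℂ G h * e * of ℂ G h = ∑ g, e.coeff g • of ℂ G (h * g * h) := by
    intro h
    conv_lhs => rw [← sum_coeff_smul_of e]
    rw [Finset.mul_sum, Finset.sum_mul]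
    simp [-of_apply]
  have h2 : ∀ g : G, ∑ h, of ℂ G (h * g * h) = squareSum G * of ℂ G g⁻¹ := by
    intro g
    rw [squareSum, Finset.sum_mul]
    refine Fintype.sum_equiv (Equiv.mulRight g) _ _ fun h => ?_
    rw [← map_mul]
    simp [mul_assoc]
  simp only [h1]
  rw [Finset.sum_comm]
  simp only [← Finset.smul_sum, h2]
  conv_lhs => rw [← sum_coeff_smul_of e]
  rw [Finset.mul_sum]
  refine Fintype.sum_equiv (Equiv.inv G) _ _ fun g => ?_
  simp [he.symm, -of_apply]

/-- The indicator is 1: by symmetry e h e = e h⁻¹ e, so Σ e h e h equals Σ e h e h⁻¹, and squares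
act on `e` as `conjSum e` does. -/
theorem squareSum_mul_eq : squareSum G * e = ((Fintype.card G : ℂ) / idealDim e) • e := by
  rw [← he.mul_conjSum]
  calc squareSum G * e = e * (squareSum G * e) := by
        rw [squareSum_comm, ← mul_assoc, he.mul_self]
    _ = ∑ h : G, (e * of ℂ G h * e) * of ℂ G h := by
        rw [he.squareSum_mul, Finset.mul_sum]
        simp only [mul_assoc]
    _ = ∑ h : G, (e * of ℂ G h * e) * of ℂ G h⁻¹ := by
        have : ∀ h : G, (e * of ℂ G h * e) * of ℂ G h = (e * of ℂ G h⁻¹ * e) * of ℂ G h := by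
          intro h
          rw [he.mul_of_mul, he.mul_of_mul, inv_inv, he.symm]
        rw [Finset.sum_congr rfl fun h _ => this h]
        refine Fintype.sum_equiv (Equiv.inv G) _ _ fun g => ?_
        simp
    _ = e * conjSum e := by
        rw [conjSum, Finset.mul_sum]
        simp only [mul_assoc]

theorem squareSum_mul_conjSum :
    squareSum G * conjSum e = ((Fintype.card G : ℂ) / idealDim e) • conjSum e := by
  rw [conjSum, Finset.mul_sum, Finset.smul_sum]
  refine Finset.sum_congr rfl fun h _ => ?_
  rw [← mul_assoc, ← mul_assoc, squareSum_comm, mul_assoc (of ℂ G h), he.squareSum_mul_eq]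
  simp [-of_apply]

/-- The left ideal generated by a primitive idempotent is minimal. -/
theorem eq_bot_or_eq_of_le {N : Submodule (MonoidAlgebra ℂ G) (MonoidAlgebra ℂ G)}
    (hN : N ≤ Submodule.span (MonoidAlgebra ℂ G) {e}) :
    N = ⊥ ∨ N = Submodule.span (MonoidAlgebra ℂ G) {e} := by
  have : NeZero (Nat.card G : ℂ) := ⟨by rw [Nat.card_eq_fintype_card]; exact card_cast_ne_zero (G := G)⟩
  obtain ⟨N', hN'⟩ := exists_isCompl N
  have hmul : ∀ x ∈ Submodule.span (MonoidAlgebra ℂ G) {e}, x * e = x := by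
    intro x hx
    obtain ⟨a, rfl⟩ := Submodule.mem_span_singleton.1 hx
    simp [mul_assoc, he.mul_self]
  obtain ⟨n, hn, n', hn', hnn⟩ := Submodule.mem_sup.1
    (show e ∈ N ⊔ N' by rw [hN'.sup_eq_top]; trivial)
  -- With e = n + n' along a Maschke complement, e n = α e. If α ≠ 0 then e lies in N; if α = 0 then
  -- e = e n' lies in N', which forces N = 0.
  obtain ⟨α, hα⟩ := he.corner n
  have h1 : e * n = α • e := by rw [← hα, mul_assoc, hmul n (hN hn)]
  by_cases h0 : α = 0
  · left
    have h2 : e * n' = e := by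
      have : e * (n + n') = e := by rw [hnn, he.mul_self]
      rwa [mul_add, h1, h0, zero_smul, zero_add] at this
    have h3 : e ∈ N' := by rw [← h2]; exact N'.smul_mem e hn'
    have h4 : N ≤ N' := hN.trans ((Submodule.span_singleton_le_iff_mem _ _).2 h3)
    have := hN'.inf_eq_bot
    rwa [inf_eq_left.2 h4] at this
  · right
    refine le_antisymm hN ((Submodule.span_singleton_le_iff_mem _ _).2 ?_)
    have h2 : α • e ∈ N := by rw [← h1]; exact N.smul_mem e hn
    have h3 := N.smul_of_tower_mem α⁻¹ h2
    rwa [smul_smul, inv_mul_cancel₀ h0, one_smul] at h3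

theorem isSimpleModule : IsSimpleModule (MonoidAlgebra ℂ G)
    (Submodule.span (MonoidAlgebra ℂ G) {e}) := by
  rw [isSimpleModule_iff_isAtom]
  refine ⟨fun h => he.ne_zero ?_, fun N hN => ?_⟩
  · rwa [Submodule.span_singleton_eq_bot] at h
  · exact (he.eq_bot_or_eq_of_le hN.le).resolve_right hN.ne

end IsSymmPrimitive

/-! ### Complete orthogonal families and the two dimension sums. -/

section Complete

variable {ι : Type} [Fintype ι] {e : ι → MonoidAlgebra ℂ G} (he : ∀ i, IsSymmPrimitive (e i))
  (horth : ∀ i j, i ≠ j → ∀ x, e i * x * e j = 0)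
include he horth

omit [Fintype ι] he in
theorem mul_conjSum_of_ne {i j : ι} (h : i ≠ j) : e i * conjSum (e j) = 0 := by
  rw [conjSum, Finset.mul_sum]
  refine Finset.sum_eq_zero fun g _ => ?_
  rw [← mul_assoc, ← mul_assoc, horth i j h, zero_mul]

/-- Left multiplication by `e i` kills all terms but the i-th, on which it is a nonzero scalar times
`e i`. -/
theorem linearIndependent_conjSum : LinearIndependent ℂ fun i => conjSum (e i) := by
  classical
  rw [Fintype.linearIndependent_iff]
  intro c hc i
  have h1 : e i * ∑ j, c j • conjSum (e j) = (c i * (Fintype.card G / idealDim (e i))) • e i := by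
    rw [Finset.mul_sum, Finset.sum_eq_single i]
    · rw [mul_smul_comm, (he i).mul_conjSum, smul_smul]
    · intro j _ hj
      rw [mul_smul_comm, mul_conjSum_of_ne horth hj.symm, smul_zero]
    · simp
  rw [hc, mul_zero, eq_comm, smul_eq_zero] at h1
  have h2 := h1.resolve_right (he i).ne_zero
  refine (mul_eq_zero.1 h2).resolve_right (div_ne_zero (card_cast_ne_zero (G := G)) ?_)
  exact_mod_cast (he i).idealDim_pos.ne'

/-- If there are enough orthogonal primitive idempotents to fill the centre, the unit is the sum
of their central supports. -/
theorem one_eq_sum_conjSum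
    (hcard : Module.finrank ℂ (Subalgebra.center ℂ (MonoidAlgebra ℂ G)) ≤ Fintype.card ι) :
    (1 : MonoidAlgebra ℂ G) =
      ∑ i, ((idealDim (e i) : ℂ) / Fintype.card G) • conjSum (e i) := by
  classical
  have hli := linearIndependent_conjSum he horth
  -- Independent central elements, at least as many as the dimension of the centre, form a basis of
  -- it.
  have hspan : Submodule.span ℂ (Set.range fun i => conjSum (e i)) =
      (Subalgebra.center ℂ (MonoidAlgebra ℂ G)).toSubmodule := by
    apply Submodule.eq_of_le_of_finrank_le
    · rw [Submodule.span_le]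
      rintro _ ⟨i, rfl⟩
      exact (Subalgebra.mem_center_iff (R := ℂ)).2 fun x => (conjSum_comm _ x).symm
    · rw [finrank_span_eq_card hli]
      exact hcard
  have h1 : (1 : MonoidAlgebra ℂ G) ∈ Submodule.span ℂ (Set.range fun i => conjSum (e i)) := by
    rw [hspan]
    exact one_mem (Subalgebra.center ℂ (MonoidAlgebra ℂ G))
  obtain ⟨c, hc⟩ := (Submodule.mem_span_range_iff_exists_fun ℂ).1 h1
  rw [← hc]
  refine Finset.sum_congr rfl fun i _ => ?_
  congr 1
  have h2 : e i * ∑ j, c j • conjSum (e j) = (c i * (Fintype.card G / idealDim (e i))) • e i := by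
    rw [Finset.mul_sum, Finset.sum_eq_single i]
    · rw [mul_smul_comm, (he i).mul_conjSum, smul_smul]
    · intro j _ hj
      rw [mul_smul_comm, mul_conjSum_of_ne horth hj.symm, smul_zero]
    · simp
  rw [hc, mul_one] at h2
  have h3 : (1 : ℂ) • e i = (c i * (Fintype.card G / idealDim (e i))) • e i := by
    rw [one_smul]; exact h2
  have h4 := smul_left_injective ℂ (he i).ne_zero h3
  have h5 : (idealDim (e i) : ℂ) ≠ 0 := by exact_mod_cast (he i).idealDim_pos.ne'
  have h6 := card_cast_ne_zero (G := G)
  field_simp at h4 ⊢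
  exact h4.symm

variable (hcard : Module.finrank ℂ (Subalgebra.center ℂ (MonoidAlgebra ℂ G)) ≤ Fintype.card ι)
include hcard

/-- Coefficient at the identity in the expansion of 1. -/
theorem sum_idealDim_sq : ∑ i, idealDim (e i) ^ 2 = Fintype.card G := by
  have h := congrArg (fun x => MonoidAlgebra.coeff x 1) (one_eq_sum_conjSum he horth hcard)
  simp only [coeff_one_one, coeff_sum, coeff_smul, Finsupp.finsetSum_apply, Finsupp.smul_apply,
    coeff_conjSum_one, smul_eq_mul, ← (he _).idealDim_eq] at h
  have hG : (Fintype.card G : ℂ) ≠ 0 := by exact_mod_cast Fintype.card_ne_zero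
  have h2 : (Fintype.card G : ℂ) = ∑ i, (idealDim (e i) : ℂ) ^ 2 := by
    rw [← mul_one (Fintype.card G : ℂ), h, Finset.mul_sum]
    refine Finset.sum_congr rfl fun i _ => ?_
    field_simp
  exact_mod_cast h2.symm

/-- The Frobenius–Schur count for a group all of whose irreducible representations are
generated by symmetric idempotents. -/
theorem sum_idealDim [DecidableEq G] :
    ∑ i, idealDim (e i) = (Finset.univ.filter fun h : G => h * h = 1).card := by
  have hG : (Fintype.card G : ℂ) ≠ 0 := by exact_mod_cast Fintype.card_ne_zero
  -- The eigenvalue |G|/d_i cancels the coefficient d_i/|G| in the expansion of 1.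
  have h1 : squareSum G = ∑ i, conjSum (e i) := by
    rw [← mul_one (squareSum G), one_eq_sum_conjSum he horth hcard, Finset.mul_sum]
    refine Finset.sum_congr rfl fun i _ => ?_
    rw [mul_smul_comm, (he i).squareSum_mul_conjSum, smul_smul]
    have h5 : (idealDim (e i) : ℂ) ≠ 0 := by exact_mod_cast (he i).idealDim_pos.ne'
    rw [div_mul_div_cancel₀ hG, div_self h5, one_smul]
  have h2 := congrArg (fun x => MonoidAlgebra.coeff x 1) h1
  simp only [coeff_squareSum_one, coeff_sum, Finsupp.finsetSum_apply, coeff_conjSum_one,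
    ← (he _).idealDim_eq] at h2
  exact_mod_cast h2.symm

/-- By the expansion of 1, some `e i` moves some w to a nonzero vector. Then a ↦ a w maps the ideal
of `e i` onto V, because V is simple. -/
theorem exists_finrank_le (V : Type) [AddCommGroup V] [Module (MonoidAlgebra ℂ G) V] [Module ℂ V]
    [IsScalarTower ℂ (MonoidAlgebra ℂ G) V] [IsSimpleModule (MonoidAlgebra ℂ G) V] :
    ∃ i, Module.finrank ℂ V ≤ idealDim (e i) := by
  have := IsSimpleModule.nontrivial (MonoidAlgebra ℂ G) V
  obtain ⟨v, hv⟩ := exists_ne (0 : V)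
  have h1 : ∃ i, ∃ w : V, e i • w ≠ 0 := by
    by_contra! hcon
    apply hv
    rw [← one_smul (MonoidAlgebra ℂ G) v, one_eq_sum_conjSum he horth hcard, Finset.sum_smul]
    refine Finset.sum_eq_zero fun i _ => ?_
    rw [smul_assoc, conjSum, Finset.sum_smul, Finset.sum_eq_zero, smul_zero]
    intro g _
    rw [mul_smul, mul_smul, hcon, smul_zero]
  obtain ⟨i, w, hw⟩ := h1
  refine ⟨i, ?_⟩
  let f : Submodule.span (MonoidAlgebra ℂ G) {e i} →ₗ[MonoidAlgebra ℂ G] V :=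
    (LinearMap.toSpanSingleton (MonoidAlgebra ℂ G) V w).comp (Submodule.subtype _)
  have hf : Function.Surjective f := by
    rw [← LinearMap.range_eq_top]
    refine (eq_bot_or_eq_top _).resolve_left fun h => hw ?_
    have : f ⟨e i, Submodule.mem_span_singleton_self _⟩ ∈ LinearMap.range f := ⟨_, rfl⟩
    rw [h, Submodule.mem_bot] at this
    exact this
  have : FiniteDimensional ℂ (Submodule.span (MonoidAlgebra ℂ G) {e i}) :=
    inferInstanceAs (FiniteDimensional ℂ
      ((Submodule.span (MonoidAlgebra ℂ G) {e i}).restrictScalars ℂ))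
  exact LinearMap.finrank_le_finrank_of_surjective (f := f.restrictScalars ℂ) hf

end Complete

end GroupAlgebra

namespace SymGroupDim

theorem perm_apply_inv_self {α : Type*} (g : Equiv.Perm α) (x : α) : g (g⁻¹ x) = x :=
  g.apply_symm_apply x

theorem perm_inv_apply_self {α : Type*} (g : Equiv.Perm α) (x : α) : g⁻¹ (g x) = x :=
  g.symm_apply_apply x

/-! ### Comparing an injection with an initial segment. -/

section Counting

variable {α : Type*}

/-- Either all values of `u` are below k, or `u` attains all of 0, …, k − 1, while an injective `f`
has at most k values there. In use, A is a column of one tableau, `u` its row index, and `f` the row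
index in another tableau. -/
theorem card_filter_lt_le (A : Finset α) (f u : α → ℕ) (hf : Set.InjOn f A)
    (hu : ∀ x ∈ A, ∀ i < u x, ∃ y ∈ A, u y = i) (k : ℕ) :
    (A.filter fun x => f x < k).card ≤ (A.filter fun x => u x < k).card := by
  classical
  by_cases h : ∀ x ∈ A, u x < k
  · rw [Finset.filter_true_of_mem h]
    exact Finset.card_filter_le _ _
  · push Not at h
    obtain ⟨x, hx, hxk⟩ := h
    have h1 : (A.filter fun x => f x < k).card ≤ k := by
      have := Finset.card_le_card_of_injOn (s := A.filter fun x => f x < k)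
        (t := Finset.range k) f (fun y hy => by simpa using (Finset.mem_filter.1 hy).2)
        (fun y hy z hz h => hf (Finset.mem_filter.1 hy).1 (Finset.mem_filter.1 hz).1 h)
      simpa using this
    refine h1.trans ?_
    have h2 : Finset.range k ⊆ (A.filter fun x => u x < k).image u := by
      intro i hi
      rw [Finset.mem_range] at hi
      rcases hxk.eq_or_lt with h | h
      · obtain ⟨y, hy, rfl⟩ := hu x hx i (by omega)
        exact Finset.mem_image_of_mem u (Finset.mem_filter.2 ⟨hy, hi⟩)
      · obtain ⟨y, hy, rfl⟩ := hu x hx i (by omega)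
        exact Finset.mem_image_of_mem u (Finset.mem_filter.2 ⟨hy, hi⟩)
    have h3 := (Finset.card_le_card h2).trans Finset.card_image_le
    simpa using h3

/-- If a function injective on `A` has as many values below each bound as an injective function
`u` whose values form an initial segment, then its values are values of `u`. -/
theorem exists_eq_of_card_filter_lt_eq (A : Finset α) (f u : α → ℕ) (hui : Set.InjOn u A)
    (hu : ∀ x ∈ A, ∀ i < u x, ∃ y ∈ A, u y = i)
    (h : ∀ k, (A.filter fun x => f x < k).card = (A.filter fun x => u x < k).card)
    {x : α} (hx : x ∈ A) : ∃ y ∈ A, u y = f x := by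
  classical
  have hlt : ∀ y ∈ A, u y < A.card := by
    intro y hy
    have h2 : Finset.range (u y + 1) ⊆ A.image u := by
      intro i hi
      rw [Finset.mem_range, Nat.lt_succ_iff] at hi
      rcases hi.eq_or_lt with rfl | hi
      · exact Finset.mem_image_of_mem u hy
      · obtain ⟨z, hz, rfl⟩ := hu y hy i hi
        exact Finset.mem_image_of_mem u hz
    have h3 := (Finset.card_le_card h2).trans Finset.card_image_le
    simpa using h3
  have himage : A.image u = Finset.range A.card := by
    refine Finset.eq_of_subset_of_card_le ?_ ?_
    · intro i hi
      obtain ⟨y, hy, rfl⟩ := Finset.mem_image.1 hi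
      exact Finset.mem_range.2 (hlt y hy)
    · rw [Finset.card_image_of_injOn hui, Finset.card_range]
  have h1 := h A.card
  rw [Finset.filter_true_of_mem hlt, Finset.card_filter_eq_iff] at h1
  have h2 : f x ∈ A.image u := by
    rw [himage, Finset.mem_range]
    exact h1 x hx
  simpa using h2

end Counting

/-! ### Tableaux, dominance and factorization of permutations. -/

section Tableaux

variable {n : ℕ} {lam mu : n.Partition}

/-- The row of an entry of a tableau. -/
def rowOf (T : Tableau lam) (x : Fin n) : ℕ := (T x).1.1

/-- The column of an entry of a tableau. -/
def colOf (T : Tableau lam) (x : Fin n) : ℕ := (T x).1.2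

theorem eq_of_rowOf_eq_of_colOf_eq {T : Tableau lam} {x y : Fin n}
    (hr : rowOf T x = rowOf T y) (hc : colOf T x = colOf T y) : x = y :=
  T.injective (Subtype.ext (Prod.ext hr hc))

theorem mem_diagram (T : Tableau lam) (x : Fin n) : (rowOf T x, colOf T x) ∈ diagram lam :=
  (T x).2

theorem exists_of_mem_diagram (T : Tableau lam) {i j : ℕ} (h : (i, j) ∈ diagram lam) :
    ∃ x, rowOf T x = i ∧ colOf T x = j :=
  ⟨T.symm ⟨(i, j), h⟩, by simp [rowOf], by simp [colOf]⟩

/-- The number of cells of the diagram in the first `k` rows. -/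
def cellsAbove (lam : n.Partition) (k : ℕ) : ℕ :=
  ((diagram lam).cells.filter fun c => c.1 < k).card

theorem card_rowOf_lt (T : Tableau lam) (k : ℕ) :
    (Finset.univ.filter fun x => rowOf T x < k).card = cellsAbove lam k := by
  refine Finset.card_bij (fun x _ => (T x).1) (fun x hx => ?_) (fun x _ y _ h => ?_)
    (fun c hc => ?_)
  · exact Finset.mem_filter.2 ⟨(T x).2, (Finset.mem_filter.1 hx).2⟩
  · exact T.injective (Subtype.ext h)
  · obtain ⟨h1, h2⟩ := Finset.mem_filter.1 hc
    exact ⟨T.symm ⟨c, h1⟩, Finset.mem_filter.2 ⟨Finset.mem_univ _, by simpa [rowOf] using h2⟩,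
      by simp⟩

theorem rowOf_initial (U : Tableau mu) (j : ℕ) (x : Fin n)
    (hx : x ∈ Finset.univ.filter fun y => colOf U y = j) (i : ℕ) (hi : i < rowOf U x) :
    ∃ y ∈ Finset.univ.filter fun y => colOf U y = j, rowOf U y = i := by
  have h1 : (i, colOf U x) ∈ diagram mu :=
    (diagram mu).up_left_mem hi.le le_rfl (mem_diagram U x)
  obtain ⟨y, hy1, hy2⟩ := exists_of_mem_diagram U h1
  exact ⟨y, Finset.mem_filter.2 ⟨Finset.mem_univ _,
    hy2.trans (Finset.mem_filter.1 hx).2⟩, hy1⟩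

theorem card_filter_eq_sum_colOf (U : Tableau mu) (p : Fin n → Prop) [DecidablePred p] :
    (Finset.univ.filter p).card =
      ∑ j ∈ Finset.univ.image (colOf U),
        ((Finset.univ.filter fun y => colOf U y = j).filter p).card := by
  rw [Finset.card_eq_sum_card_fiberwise (f := colOf U) (t := Finset.univ.image (colOf U))]
  · refine Finset.sum_congr rfl fun j _ => ?_
    rw [Finset.filter_comm]
  · intro x _
    simp

section NoCollision

variable {T : Tableau lam} {U : Tableau mu}
  (h : ∀ x y, rowOf T x = rowOf T y → colOf U x = colOf U y → x = y)
include h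

theorem injOn_rowOf_of_forall (j : ℕ) :
    Set.InjOn (rowOf T) (Finset.univ.filter fun y => colOf U y = j : Finset (Fin n)) := by
  intro x hx y hy hxy
  simp only [Finset.coe_filter, Finset.mem_univ, true_and, Set.mem_ofPred_eq] at hx hy
  exact h x y hxy (hx.trans hy.symm)

/-- Dominance: each column of U has its entries in distinct rows of T, so at most as many of them
lie in the first k rows of T as of U. Sum over the columns. -/
theorem cellsAbove_le_of_forall (k : ℕ) : cellsAbove lam k ≤ cellsAbove mu k := by
  rw [← card_rowOf_lt T, ← card_rowOf_lt U, card_filter_eq_sum_colOf U,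
    card_filter_eq_sum_colOf U]
  exact Finset.sum_le_sum fun j _ =>
    card_filter_lt_le _ _ _ (injOn_rowOf_of_forall h j) (rowOf_initial U j) k

end NoCollision

/-- For equal shapes the dominance totals agree, so the inequality is an equality in every column.
Hence the entries of a column of U occupy in T exactly the rows that the column has. -/
theorem mem_diagram_of_forall {T U : Tableau lam}
    (h : ∀ x y, rowOf T x = rowOf T y → colOf U x = colOf U y → x = y) (x : Fin n) :
    (rowOf T x, colOf U x) ∈ diagram lam := by
  have key : ∀ j ∈ Finset.univ.image (colOf U), ∀ k,
      ((Finset.univ.filter fun y => colOf U y = j).filter fun y => rowOf T y < k).card =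
      ((Finset.univ.filter fun y => colOf U y = j).filter fun y => rowOf U y < k).card := by
    intro j hj k
    refine (Finset.sum_eq_sum_iff_of_le fun j _ =>
      card_filter_lt_le _ _ _ (injOn_rowOf_of_forall h j) (rowOf_initial U j) k).1 ?_ j hj
    rw [← card_filter_eq_sum_colOf U, ← card_filter_eq_sum_colOf U, card_rowOf_lt, card_rowOf_lt]
  have hinj : Set.InjOn (rowOf U)
      (Finset.univ.filter fun y => colOf U y = colOf U x : Finset (Fin n)) :=
    injOn_rowOf_of_forall (T := U) (U := U) (fun _ _ => eq_of_rowOf_eq_of_colOf_eq) _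
  obtain ⟨y, hy, hyx⟩ := exists_eq_of_card_filter_lt_eq _ _ _ hinj (rowOf_initial U (colOf U x))
    (key (colOf U x) (Finset.mem_image_of_mem _ (Finset.mem_univ _)))
    (x := x) (by simp)
  rw [← hyx, ← (Finset.mem_filter.1 hy).2]
  exact mem_diagram U y

theorem mem_rowGroup {T : Tableau lam} {g : Equiv.Perm (Fin n)} :
    g ∈ rowGroup T ↔ ∀ x, rowOf T (g x) = rowOf T x := by
  simp [rowGroup, rowOf]

theorem mem_colGroup {T : Tableau lam} {g : Equiv.Perm (Fin n)} :
    g ∈ colGroup T ↔ ∀ x, colOf T (g x) = colOf T x := by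
  simp [colGroup, colOf]

/-- If no two entries lie in one row of `T` and one column of `T ∘ g⁻¹`, then `g` is the product
of a row and a column permutation. -/
theorem exists_mul_eq_of_forall {T : Tableau lam} {g : Equiv.Perm (Fin n)}
    (h : ∀ x y, rowOf T x = rowOf T y → colOf T (g⁻¹ x) = colOf T (g⁻¹ y) → x = y) :
    ∃ p ∈ rowGroup T, ∃ q ∈ colGroup T, p * q = g := by
  let U : Tableau lam := (g⁻¹ : Equiv.Perm (Fin n)).trans T
  have hmem := mem_diagram_of_forall (T := T) (U := U) h
  -- `f` keeps the row of x and takes the column of g⁻¹ x. As a permutation p it preserves rows and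
  -- p g preserves columns, so g = p⁻¹ (p g).
  let f : Fin n → Fin n := fun x => T.symm ⟨(rowOf T x, colOf U x), hmem x⟩
  have hfr : ∀ x, rowOf T (f x) = rowOf T x := fun x => by simp [f, rowOf]
  have hfc : ∀ x, colOf T (f x) = colOf T (g⁻¹ x) := fun x => by simp [f, colOf, U]
  have hf : Function.Injective f := by
    intro x y hxy
    exact h x y (by rw [← hfr x, hxy, hfr]) (by rw [← hfc x, hxy, hfc])
  let p : Equiv.Perm (Fin n) := Equiv.ofBijective f (Finite.injective_iff_bijective.1 hf)
  have hp : ∀ x, p x = f x := fun x => rfl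
  refine ⟨p⁻¹, mem_rowGroup.2 fun x => ?_, p * g, mem_colGroup.2 fun x => ?_, by group⟩
  · rw [← hfr, ← hp, perm_apply_inv_self]
  · rw [Equiv.Perm.mul_apply, hp, hfc, perm_inv_apply_self]

/-- Successive differences are the row lengths, which recover the partition because its parts are
positive. -/
theorem eq_of_cellsAbove_eq (h : ∀ k, cellsAbove lam k = cellsAbove mu k) : lam = mu := by
  have hstep : ∀ (nu : n.Partition) k,
      cellsAbove nu (k + 1) = cellsAbove nu k + (diagram nu).rowLen k := by
    intro nu k
    rw [YoungDiagram.rowLen_eq_card, cellsAbove, cellsAbove, YoungDiagram.row,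
      ← Finset.card_union_of_disjoint]
    · congr 1
      ext c
      simp only [Finset.mem_filter, Finset.mem_union]
      constructor
      · rintro ⟨h1, h2⟩
        rcases (Nat.lt_succ_iff.1 h2).lt_or_eq with h3 | h3
        · exact Or.inl ⟨h1, h3⟩
        · exact Or.inr ⟨h1, h3⟩
      · rintro (⟨h1, h2⟩ | ⟨h1, h2⟩)
        · exact ⟨h1, by omega⟩
        · exact ⟨h1, by omega⟩
    · rw [Finset.disjoint_left]
      intro c h1 h2
      have := (Finset.mem_filter.1 h1).2
      have := (Finset.mem_filter.1 h2).2
      omega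
  have hrow : ∀ k, (diagram lam).rowLen k = (diagram mu).rowLen k := by
    intro k
    have h1 := hstep lam k
    have h2 := hstep mu k
    rw [h, h, h2] at h1
    omega
  have hd : diagram lam = diagram mu := by
    refine YoungDiagram.ext (Finset.ext fun c => ?_)
    obtain ⟨i, j⟩ := c
    rw [YoungDiagram.mem_cells, YoungDiagram.mem_cells, YoungDiagram.mem_iff_lt_rowLen,
      YoungDiagram.mem_iff_lt_rowLen, hrow]
  have hpos : ∀ nu : n.Partition, ∀ x ∈ partsList nu, 0 < x := fun nu x hx =>
    nu.parts_pos ((Multiset.mem_sort _).1 hx)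
  have hl : partsList lam = partsList mu := by
    have h1 := YoungDiagram.rowLens_ofRowLens_eq_self (hw := partsList_sortedGE lam) (hpos lam)
    have h2 := YoungDiagram.rowLens_ofRowLens_eq_self (hw := partsList_sortedGE mu) (hpos mu)
    rw [← h1, ← h2]
    exact congrArg YoungDiagram.rowLens hd
  refine Nat.Partition.ext ?_
  rw [← Multiset.sort_eq lam.parts (fun a b => b ≤ a), ← Multiset.sort_eq mu.parts
    (fun a b => b ≤ a)]
  exact congrArg _ hl

end Tableaux

/-! ### Young symmetrizers and Specht modules. -/

section Symmetrizers

open MonoidAlgebra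

variable {n : ℕ} {lam mu : n.Partition}

/-- The sum of the row group. -/
noncomputable def rowSum (T : Tableau lam) : MonoidAlgebra ℂ (Equiv.Perm (Fin n)) :=
  ∑ p ∈ rowGroup T, of ℂ _ p

/-- The signed sum of the column group. -/
noncomputable def colSum (T : Tableau lam) : MonoidAlgebra ℂ (Equiv.Perm (Fin n)) :=
  ∑ q ∈ colGroup T, ((Equiv.Perm.sign q : ℤ) : ℂ) • of ℂ _ q

theorem youngSymmetrizer_eq (T : Tableau lam) : youngSymmetrizer T = rowSum T * colSum T := by
  simp [youngSymmetrizer, rowSum, colSum]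

theorem mul_mem_rowGroup {T : Tableau lam} {p q : Equiv.Perm (Fin n)} (hp : p ∈ rowGroup T)
    (hq : q ∈ rowGroup T) : p * q ∈ rowGroup T := by
  rw [mem_rowGroup] at *
  intro x
  rw [Equiv.Perm.mul_apply, hp, hq]

theorem inv_mem_rowGroup {T : Tableau lam} {p : Equiv.Perm (Fin n)} (hp : p ∈ rowGroup T) :
    p⁻¹ ∈ rowGroup T := by
  rw [mem_rowGroup] at *
  intro x
  rw [← hp, perm_apply_inv_self]

theorem mul_mem_colGroup {T : Tableau lam} {p q : Equiv.Perm (Fin n)} (hp : p ∈ colGroup T)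
    (hq : q ∈ colGroup T) : p * q ∈ colGroup T := by
  rw [mem_colGroup] at *
  intro x
  rw [Equiv.Perm.mul_apply, hp, hq]

theorem inv_mem_colGroup {T : Tableau lam} {p : Equiv.Perm (Fin n)} (hp : p ∈ colGroup T) :
    p⁻¹ ∈ colGroup T := by
  rw [mem_colGroup] at *
  intro x
  rw [← hp, perm_apply_inv_self]

theorem rowSum_mul_of {T : Tableau lam} {p : Equiv.Perm (Fin n)} (hp : p ∈ rowGroup T) :
    rowSum T * of ℂ _ p = rowSum T := by
  rw [rowSum, Finset.sum_mul]
  refine Finset.sum_bij' (fun r _ => r * p) (fun r _ => r * p⁻¹)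
    (fun r hr => mul_mem_rowGroup hr hp) (fun r hr => mul_mem_rowGroup hr (inv_mem_rowGroup hp))
    (by simp) (by simp) fun r _ => (map_mul _ r p).symm

theorem of_mul_rowSum {T : Tableau lam} {p : Equiv.Perm (Fin n)} (hp : p ∈ rowGroup T) :
    of ℂ _ p * rowSum T = rowSum T := by
  rw [rowSum, Finset.mul_sum]
  refine Finset.sum_bij' (fun r _ => p * r) (fun r _ => p⁻¹ * r)
    (fun r hr => mul_mem_rowGroup hp hr) (fun r hr => mul_mem_rowGroup (inv_mem_rowGroup hp) hr)
    (by simp) (by simp) fun r _ => (map_mul _ p r).symm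

theorem sign_cast_mul_self (p : Equiv.Perm (Fin n)) :
    ((Equiv.Perm.sign p : ℤ) : ℂ) * ((Equiv.Perm.sign p : ℤ) : ℂ) = 1 := by
  rcases Int.units_eq_one_or (Equiv.Perm.sign p) with h | h <;> simp [h]

theorem of_mul_colSum {T : Tableau lam} {p : Equiv.Perm (Fin n)} (hp : p ∈ colGroup T) :
    of ℂ _ p * colSum T = ((Equiv.Perm.sign p : ℤ) : ℂ) • colSum T := by
  rw [colSum, Finset.mul_sum, Finset.smul_sum]
  refine Finset.sum_bij' (fun r _ => p * r) (fun r _ => p⁻¹ * r)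
    (fun r hr => mul_mem_colGroup hp hr) (fun r hr => mul_mem_colGroup (inv_mem_colGroup hp) hr)
    (by simp) (by simp) fun r _ => ?_
  rw [mul_smul_comm, ← map_mul, smul_smul, Equiv.Perm.sign_mul, Units.val_mul, Int.cast_mul,
    ← mul_assoc, sign_cast_mul_self, one_mul]

theorem colSum_mul_of {T : Tableau lam} {p : Equiv.Perm (Fin n)} (hp : p ∈ colGroup T) :
    colSum T * of ℂ _ p = ((Equiv.Perm.sign p : ℤ) : ℂ) • colSum T := by
  rw [colSum, Finset.sum_mul, Finset.smul_sum]
  refine Finset.sum_bij' (fun r _ => r * p) (fun r _ => r * p⁻¹)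
    (fun r hr => mul_mem_colGroup hr hp) (fun r hr => mul_mem_colGroup hr (inv_mem_colGroup hp))
    (by simp) (by simp) fun r _ => ?_
  rw [smul_mul_assoc, ← map_mul, smul_smul, Equiv.Perm.sign_mul, Units.val_mul, Int.cast_mul,
    mul_comm (((Equiv.Perm.sign r : ℤ) : ℂ)), ← mul_assoc, sign_cast_mul_self, one_mul]

theorem eq_zero_of_eq_neg_smul {x : MonoidAlgebra ℂ (Equiv.Perm (Fin n))}
    (h : x = (-1 : ℂ) • x) : x = 0 := by
  have h1 : (2 : ℂ) • x = 0 := by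
    rw [show (2 : ℂ) = 1 - (-1) by norm_num, sub_smul, ← h, one_smul, sub_self]
  exact (smul_eq_zero.1 h1).resolve_left two_ne_zero

theorem swap_mem_rowGroup {T : Tableau lam} {x y : Fin n} (h : rowOf T x = rowOf T y) :
    Equiv.swap x y ∈ rowGroup T := by
  rw [mem_rowGroup]
  intro z
  rw [Equiv.swap_apply_def]
  split_ifs with h1 h2
  · rw [h1, h]
  · rw [h2, h]
  · rfl

theorem swap_mem_colGroup {T : Tableau lam} {x y : Fin n} (h : colOf T x = colOf T y) :
    Equiv.swap x y ∈ colGroup T := by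
  rw [mem_colGroup]
  intro z
  rw [Equiv.swap_apply_def]
  split_ifs with h1 h2
  · rw [h1, h]
  · rw [h2, h]
  · rfl

/-- The swap of x and y is absorbed by the row sum. Moved past g it becomes a column swap of U,
absorbed with sign −1, so the product equals its own negative. -/
theorem rowSum_mul_colSum_of_collision {T : Tableau lam} {U : Tableau mu}
    {g : Equiv.Perm (Fin n)} {x y : Fin n} (hxy : x ≠ y) (hr : rowOf T x = rowOf T y)
    (hc : colOf U (g⁻¹ x) = colOf U (g⁻¹ y)) : rowSum T * of ℂ _ g * colSum U = 0 := by
  apply eq_zero_of_eq_neg_smul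
  have hs : Equiv.swap x y * g = g * Equiv.swap (g⁻¹ x) (g⁻¹ y) := by
    have := Equiv.swap_apply_apply g (g⁻¹ x) (g⁻¹ y)
    rw [perm_apply_inv_self, perm_apply_inv_self] at this
    rw [this]
    group
  have hsign : Equiv.Perm.sign (Equiv.swap (g⁻¹ x) (g⁻¹ y)) = -1 :=
    Equiv.Perm.sign_swap fun h => hxy (g⁻¹.injective h)
  calc rowSum T * of ℂ _ g * colSum U
      = rowSum T * of ℂ _ (Equiv.swap x y) * of ℂ _ g * colSum U := by
        rw [rowSum_mul_of (swap_mem_rowGroup hr)]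
    _ = rowSum T * of ℂ _ g * (of ℂ _ (Equiv.swap (g⁻¹ x) (g⁻¹ y)) * colSum U) := by
        rw [mul_assoc (rowSum T), ← map_mul, hs, map_mul]
        simp only [mul_assoc]
    _ = _ := by
        rw [of_mul_colSum (swap_mem_colGroup hc), hsign, mul_smul_comm]
        simp

theorem colSum_mul_rowSum_of_collision {T : Tableau lam} {U : Tableau mu}
    {g : Equiv.Perm (Fin n)} {x y : Fin n} (hxy : x ≠ y) (hr : colOf T x = colOf T y)
    (hc : rowOf U (g⁻¹ x) = rowOf U (g⁻¹ y)) : colSum T * of ℂ _ g * rowSum U = 0 := by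
  apply eq_zero_of_eq_neg_smul
  have hs : Equiv.swap x y * g = g * Equiv.swap (g⁻¹ x) (g⁻¹ y) := by
    have := Equiv.swap_apply_apply g (g⁻¹ x) (g⁻¹ y)
    rw [perm_apply_inv_self, perm_apply_inv_self] at this
    rw [this]
    group
  have hsign : Equiv.Perm.sign (Equiv.swap x y) = -1 := Equiv.Perm.sign_swap hxy
  have h1 : colSum T = (-1 : ℂ) • (colSum T * of ℂ _ (Equiv.swap x y)) := by
    rw [colSum_mul_of (swap_mem_colGroup hr), hsign, smul_smul]
    simp
  calc colSum T * of ℂ _ g * rowSum U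
      = (-1 : ℂ) • (colSum T * of ℂ _ (Equiv.swap x y) * of ℂ _ g * rowSum U) := by
        conv_lhs => rw [h1]
        simp only [smul_mul_assoc]
    _ = (-1 : ℂ) • (colSum T * of ℂ _ g * (of ℂ _ (Equiv.swap (g⁻¹ x) (g⁻¹ y)) * rowSum U)) := by
        rw [mul_assoc (colSum T), ← map_mul, hs, map_mul]
        simp only [mul_assoc]
    _ = _ := by rw [of_mul_rowSum (swap_mem_rowGroup hc)]

/-- An identity linear in a group algebra element follows from the case of group elements. -/
theorem mul_mul_mem_of_forall {S : Submodule ℂ (MonoidAlgebra ℂ (Equiv.Perm (Fin n)))}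
    {a b : MonoidAlgebra ℂ (Equiv.Perm (Fin n))} (h : ∀ g, a * of ℂ _ g * b ∈ S)
    (x : MonoidAlgebra ℂ (Equiv.Perm (Fin n))) : a * x * b ∈ S := by
  rw [← GroupAlgebra.sum_coeff_smul_of x, Finset.mul_sum, Finset.sum_mul]
  refine Submodule.sum_mem _ fun g _ => ?_
  rw [mul_smul_comm, smul_mul_assoc]
  exact S.smul_mem _ (h g)

theorem cellsAbove_le_of_ne_zero {T : Tableau lam} {U : Tableau mu}
    {x : MonoidAlgebra ℂ (Equiv.Perm (Fin n))} (h : rowSum T * x * colSum U ≠ 0) (k : ℕ) :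
    cellsAbove lam k ≤ cellsAbove mu k := by
  by_contra hcon
  refine h (mul_mul_mem_of_forall (S := ⊥) (fun g => ?_) x)
  rw [Submodule.mem_bot]
  by_contra hg
  refine hcon (cellsAbove_le_of_forall (T := T)
    (U := (g⁻¹ : Equiv.Perm (Fin n)).trans U) (fun x y hr hc => ?_) k)
  by_contra hxy
  exact hg (rowSum_mul_colSum_of_collision hxy hr hc)

theorem cellsAbove_le_of_ne_zero' {T : Tableau lam} {U : Tableau mu}
    {x : MonoidAlgebra ℂ (Equiv.Perm (Fin n))} (h : colSum T * x * rowSum U ≠ 0) (k : ℕ) :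
    cellsAbove mu k ≤ cellsAbove lam k := by
  by_contra hcon
  refine h (mul_mul_mem_of_forall (S := ⊥) (fun g => ?_) x)
  rw [Submodule.mem_bot]
  by_contra hg
  -- Rows now come from U and columns from T, so it is T that is transported by g.
  refine hcon (cellsAbove_le_of_forall (T := U)
    (U := (g : Equiv.Perm (Fin n)).trans T) (fun x y hr hc => ?_) k)
  by_contra hxy
  refine hg (colSum_mul_rowSum_of_collision (x := g x) (y := g y)
    (fun h => hxy (g.injective h)) hc ?_)
  rwa [perm_inv_apply_self, perm_inv_apply_self]

/-- A group element either factors as row times column permutation, giving ± the symmetrizer, or has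
a collision, giving 0. -/
theorem exists_rowSum_mul_mul_colSum (T : Tableau lam)
    (x : MonoidAlgebra ℂ (Equiv.Perm (Fin n))) :
    ∃ α : ℂ, rowSum T * x * colSum T = α • (rowSum T * colSum T) := by
  have := mul_mul_mem_of_forall (S := Submodule.span ℂ {rowSum T * colSum T})
    (a := rowSum T) (b := colSum T) (fun g => ?_) x
  · obtain ⟨α, hα⟩ := Submodule.mem_span_singleton.1 this
    exact ⟨α, hα.symm⟩
  · by_cases hg : ∀ x y, rowOf T x = rowOf T y → colOf T (g⁻¹ x) = colOf T (g⁻¹ y) → x = y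
    · obtain ⟨p, hp, q, hq, rfl⟩ := exists_mul_eq_of_forall hg
      rw [map_mul, ← mul_assoc, rowSum_mul_of hp, mul_assoc, of_mul_colSum hq, mul_smul_comm]
      exact Submodule.smul_mem _ _ (Submodule.mem_span_singleton_self _)
    · push Not at hg
      obtain ⟨x, y, hr, hc, hxy⟩ := hg
      rw [rowSum_mul_colSum_of_collision hxy hr hc]
      exact Submodule.zero_mem _

theorem coeff_rowSum (T : Tableau lam) (g : Equiv.Perm (Fin n)) :
    (rowSum T).coeff g = if g ∈ rowGroup T then 1 else 0 := by
  simp [rowSum, coeff_sum, Finsupp.single_apply]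

theorem coeff_colSum (T : Tableau lam) (g : Equiv.Perm (Fin n)) :
    (colSum T).coeff g = if g ∈ colGroup T then ((Equiv.Perm.sign g : ℤ) : ℂ) else 0 := by
  simp [colSum, coeff_sum, Finsupp.single_apply]

theorem coeff_rowSum_inv (T : Tableau lam) (g : Equiv.Perm (Fin n)) :
    (rowSum T).coeff g⁻¹ = (rowSum T).coeff g := by
  rw [coeff_rowSum, coeff_rowSum]
  exact if_congr ⟨fun h => inv_inv g ▸ inv_mem_rowGroup h, inv_mem_rowGroup⟩ rfl rfl

theorem coeff_colSum_inv (T : Tableau lam) (g : Equiv.Perm (Fin n)) :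
    (colSum T).coeff g⁻¹ = (colSum T).coeff g := by
  rw [coeff_colSum, coeff_colSum, Equiv.Perm.sign_inv]
  exact if_congr ⟨fun h => inv_inv g ▸ inv_mem_colGroup h, inv_mem_colGroup⟩ rfl rfl

theorem coeff_mul_inv {G : Type} [Group G] [Fintype G] {x y x' y' : MonoidAlgebra ℂ G}
    (hx : ∀ g, x.coeff g⁻¹ = x'.coeff g) (hy : ∀ g, y.coeff g⁻¹ = y'.coeff g) (g : G) :
    (x * y).coeff g⁻¹ = (y' * x').coeff g := by
  rw [GroupAlgebra.coeff_mul_eq_sum, GroupAlgebra.coeff_mul_eq_sum]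
  refine Fintype.sum_equiv (Equiv.mulLeft g) _ _ fun h => ?_
  rw [Equiv.coe_mulLeft, ← hx, ← hy, mul_comm]
  simp

/-- Only the identity lies in both the row and the column group. -/
theorem coeff_one_rowSum_mul_colSum (T : Tableau lam) :
    (rowSum T * colSum T).coeff 1 = 1 := by
  rw [GroupAlgebra.coeff_mul_eq_sum, Finset.sum_eq_single 1]
  · have h1 : (1 : Equiv.Perm (Fin n)) ∈ rowGroup T := mem_rowGroup.2 fun _ => rfl
    have h2 : (1 : Equiv.Perm (Fin n)) ∈ colGroup T := mem_colGroup.2 fun _ => rfl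
    simp [coeff_rowSum, coeff_colSum, h1, h2]
  · intro g _ hg
    rw [mul_one, coeff_colSum_inv, coeff_rowSum, coeff_colSum]
    by_cases h1 : g ∈ rowGroup T
    · by_cases h2 : g ∈ colGroup T
      · exact absurd (Equiv.ext fun x => eq_of_rowOf_eq_of_colOf_eq
          (mem_rowGroup.1 h1 x) (mem_colGroup.1 h2 x)) hg
      · simp [h2]
    · simp [h1]
  · simp

/-- The scalar by which a Young symmetrizer fails to be idempotent is nonzero. -/
theorem exists_youngSymmetrizer_sq (T : Tableau lam) : ∃ κ : ℂ, κ ≠ 0 ∧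
    rowSum T * colSum T * (rowSum T * colSum T) = κ • (rowSum T * colSum T) := by
  obtain ⟨κ, hκ⟩ := exists_rowSum_mul_mul_colSum T (colSum T * rowSum T)
  have h1 : rowSum T * colSum T * (rowSum T * colSum T) = κ • (rowSum T * colSum T) := by
    rw [← hκ]
    simp only [mul_assoc]
  refine ⟨κ, fun h0 => ?_, h1⟩
  rw [h0, zero_smul] at h1
  -- With scalar 0, right multiplication would be nilpotent of trace 0, but its trace is n! times
  -- the coefficient 1 at the identity.
  have hnil : IsNilpotent (LinearMap.mulRight ℂ (rowSum T * colSum T)) := by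
    refine ⟨2, LinearMap.ext fun x => ?_⟩
    rw [pow_two, Module.End.mul_apply, LinearMap.mulRight_apply, LinearMap.mulRight_apply,
      mul_assoc, h1, mul_zero, LinearMap.zero_apply]
  have htr := (LinearMap.isNilpotent_trace_of_isNilpotent hnil).eq_zero
  rw [GroupAlgebra.trace_mulRight, coeff_one_rowSum_mul_colSum, mul_one] at htr
  exact GroupAlgebra.card_cast_ne_zero htr

theorem rowSum_mul_rowSum (T : Tableau lam) :
    rowSum T * rowSum T = ((rowGroup T).card : ℂ) • rowSum T := by
  conv_lhs => enter [2]; rw [rowSum]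
  rw [Finset.mul_sum, Finset.sum_congr rfl fun p hp => rowSum_mul_of hp, Finset.sum_const,
    Nat.cast_smul_eq_nsmul]

theorem card_rowGroup_ne_zero (T : Tableau lam) : ((rowGroup T).card : ℂ) ≠ 0 := by
  have h1 : (1 : Equiv.Perm (Fin n)) ∈ rowGroup T := mem_rowGroup.2 fun _ => rfl
  exact_mod_cast (Finset.card_pos.2 ⟨1, h1⟩).ne'

/-- Inversion reverses products, so ab becomes ba while the palindrome aba is invariant. Its square
is |R| κ times itself, where κ is the scalar for ab; this fixes c. -/
theorem exists_symmPrimitive (T : Tableau lam) : ∃ c : ℂ, c ≠ 0 ∧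
    GroupAlgebra.IsSymmPrimitive (c • (rowSum T * colSum T * rowSum T)) := by
  obtain ⟨κ, hκ0, hκ⟩ := exists_youngSymmetrizer_sq T
  have hR := card_rowGroup_ne_zero T
  have hab : rowSum T * colSum T ≠ 0 := by
    intro h
    have := coeff_one_rowSum_mul_colSum T
    rw [h] at this
    simp at this
  have habab : ∀ x, ∃ α : ℂ, rowSum T * colSum T * rowSum T * x *
      (rowSum T * colSum T * rowSum T) = α • (rowSum T * colSum T * rowSum T) := by
    intro x
    obtain ⟨α, hα⟩ := exists_rowSum_mul_mul_colSum T (colSum T * rowSum T * x * rowSum T)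
    refine ⟨α, ?_⟩
    rw [← smul_mul_assoc, ← hα]
    simp only [mul_assoc]
  have hsq : rowSum T * colSum T * rowSum T * (rowSum T * colSum T * rowSum T) =
      (((rowGroup T).card : ℂ) * κ) • (rowSum T * colSum T * rowSum T) := by
    calc _ = rowSum T * colSum T * (rowSum T * rowSum T) * colSum T * rowSum T := by
          simp only [mul_assoc]
      _ = ((rowGroup T).card : ℂ) •
          (rowSum T * colSum T * (rowSum T * colSum T) * rowSum T) := by
          rw [rowSum_mul_rowSum]
          simp only [mul_assoc, mul_smul_comm, smul_mul_assoc]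
      _ = _ := by
          rw [hκ, smul_mul_assoc, smul_smul]
  have hc : (((rowGroup T).card : ℂ) * κ)⁻¹ ≠ 0 := inv_ne_zero (mul_ne_zero hR hκ0)
  refine ⟨(((rowGroup T).card : ℂ) * κ)⁻¹, hc, ?_, ?_, ?_, ?_⟩
  · refine smul_ne_zero hc fun h => ?_
    have h1 : κ • (rowSum T * colSum T) = 0 := by
      rw [← hκ, ← mul_assoc, h, zero_mul]
    exact hab ((smul_eq_zero.1 h1).resolve_left hκ0)
  · rw [smul_mul_smul_comm, hsq, smul_smul, inv_mul_cancel_right₀ (mul_ne_zero hR hκ0)]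
  · intro x
    obtain ⟨α, hα⟩ := habab x
    refine ⟨(((rowGroup T).card : ℂ) * κ)⁻¹ * α, ?_⟩
    rw [smul_mul_assoc, smul_mul_assoc, mul_smul_comm, hα]
    simp only [smul_smul]
    congr 1
    ring
  · intro g
    rw [coeff_smul_apply, coeff_smul_apply, mul_assoc,
      coeff_mul_inv (coeff_rowSum_inv T) (coeff_mul_inv (coeff_colSum_inv T) (coeff_rowSum_inv T)),
      mul_assoc]

/-- A symmetric primitive idempotent which generates a module isomorphic to the Specht module. -/
noncomputable def primIdem (lam : n.Partition) : MonoidAlgebra ℂ (Equiv.Perm (Fin n)) :=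
  (exists_symmPrimitive (tableau lam)).choose •
    (rowSum (tableau lam) * colSum (tableau lam) * rowSum (tableau lam))

theorem primIdem_isSymmPrimitive (lam : n.Partition) :
    GroupAlgebra.IsSymmPrimitive (primIdem lam) :=
  (exists_symmPrimitive (tableau lam)).choose_spec.2

/-- A nonzero product aba x a'b'a' contains nonzero factors a(…)b' and b(…)a', which give opposite
dominance inequalities. -/
theorem primIdem_mul_mul_primIdem (h : lam ≠ mu) (x : MonoidAlgebra ℂ (Equiv.Perm (Fin n))) :
    primIdem lam * x * primIdem mu = 0 := by
  by_contra hne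
  refine h (eq_of_cellsAbove_eq fun k => le_antisymm ?_ ?_)
  · refine cellsAbove_le_of_ne_zero (T := tableau lam) (U := tableau mu)
      (x := colSum (tableau lam) * rowSum (tableau lam) * x * rowSum (tableau mu))
      (fun h0 => hne ?_) k
    rw [primIdem, primIdem, smul_mul_assoc, smul_mul_smul_comm]
    have : rowSum (tableau lam) * colSum (tableau lam) * rowSum (tableau lam) * x *
        (rowSum (tableau mu) * colSum (tableau mu) * rowSum (tableau mu)) =
        rowSum (tableau lam) * (colSum (tableau lam) * rowSum (tableau lam) * x *
          rowSum (tableau mu)) * colSum (tableau mu) * rowSum (tableau mu) := by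
      simp only [mul_assoc]
    rw [this, h0, zero_mul, smul_zero]
  · refine cellsAbove_le_of_ne_zero' (T := tableau lam) (U := tableau mu)
      (x := rowSum (tableau lam) * x) (fun h0 => hne ?_) k
    rw [primIdem, primIdem, smul_mul_assoc, smul_mul_smul_comm]
    have : rowSum (tableau lam) * colSum (tableau lam) * rowSum (tableau lam) * x *
        (rowSum (tableau mu) * colSum (tableau mu) * rowSum (tableau mu)) =
        rowSum (tableau lam) * (colSum (tableau lam) * (rowSum (tableau lam) * x) *
          rowSum (tableau mu)) * colSum (tableau mu) * rowSum (tableau mu) := by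
      simp only [mul_assoc]
    rw [this, h0, mul_zero, zero_mul, zero_mul, smul_zero]

theorem finrank_span_mul_le {G : Type} [Group G] [Fintype G] (x y : MonoidAlgebra ℂ G) :
    GroupAlgebra.idealDim (x * y) ≤ GroupAlgebra.idealDim x := by
  have h1 : Submodule.span (MonoidAlgebra ℂ G) {x * y} =
      (Submodule.span (MonoidAlgebra ℂ G) {x}).map
        (LinearMap.toSpanSingleton (MonoidAlgebra ℂ G) (MonoidAlgebra ℂ G) y) := by
    rw [Submodule.map_span, Set.image_singleton, LinearMap.toSpanSingleton_apply, smul_eq_mul]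
  have h2 := Submodule.finrank_map_le (R := ℂ)
    ((LinearMap.toSpanSingleton (MonoidAlgebra ℂ G) (MonoidAlgebra ℂ G) y).restrictScalars ℂ)
    ((Submodule.span (MonoidAlgebra ℂ G) {x}).restrictScalars ℂ)
  rw [GroupAlgebra.idealDim, h1]
  exact h2

/-- Up to nonzero scalars ab and aba are right multiples of each other, as (ab)a = aba and (aba)b =
κ ab. -/
theorem idealDim_primIdem (lam : n.Partition) :
    GroupAlgebra.idealDim (primIdem lam) = dimSpecht lam := by
  have hd : dimSpecht lam =
      GroupAlgebra.idealDim (rowSum (tableau lam) * colSum (tableau lam)) := by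
    rw [dimSpecht, spechtModule, youngSymmetrizer_eq]
    rfl
  rw [hd]
  set T := tableau lam
  have hc0 : (exists_symmPrimitive T).choose ≠ 0 := (exists_symmPrimitive T).choose_spec.1
  obtain ⟨κ, hκ0, hκ⟩ := exists_youngSymmetrizer_sq T
  refine le_antisymm ?_ ?_
  · have : primIdem lam = rowSum T * colSum T * ((exists_symmPrimitive T).choose • rowSum T) := by
      rw [mul_smul_comm]; rfl
    rw [this]
    exact finrank_span_mul_le _ _
  · have : rowSum T * colSum T = primIdem lam *
        ((((exists_symmPrimitive T).choose) * κ)⁻¹ • colSum T) := by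
      rw [mul_smul_comm]
      change _ = _ • ((exists_symmPrimitive T).choose • (rowSum T * colSum T * rowSum T) *
        colSum T)
      rw [smul_mul_assoc, mul_assoc _ (rowSum T), hκ, smul_smul, smul_smul,
        mul_assoc, inv_mul_cancel₀ (mul_ne_zero hc0 hκ0), one_smul]
    conv_lhs => rw [this]
    exact finrank_span_mul_le _ _

/-- Coefficients of a central element depend only on the cycle type. -/
theorem finrank_center_le (n : ℕ) :
    Module.finrank ℂ (Subalgebra.center ℂ (MonoidAlgebra ℂ (Equiv.Perm (Fin n)))) ≤
      Fintype.card n.Partition := by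
  have hn : Fintype.card (Fin n) = n := Fintype.card_fin n
  let f : (((Fintype.card (Fin n)).Partition) → ℂ) →ₗ[ℂ]
      MonoidAlgebra ℂ (Equiv.Perm (Fin n)) :=
    { toFun := fun φ => ∑ g : Equiv.Perm (Fin n), φ g.partition • of ℂ _ g
      map_add' := fun φ ψ => by simp only [Pi.add_apply, add_smul, Finset.sum_add_distrib]
      map_smul' := fun c φ => by
        simp only [Pi.smul_apply, smul_eq_mul, mul_smul, Finset.smul_sum, RingHom.id_apply] }
  have hle : (Subalgebra.center ℂ (MonoidAlgebra ℂ (Equiv.Perm (Fin n)))).toSubmodule ≤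
      LinearMap.range f := by
    intro x hx
    have hx' : ∀ y, y * x = x * y := (Subalgebra.mem_center_iff (R := ℂ)).1 hx
    have hconj : ∀ g h : Equiv.Perm (Fin n), g.partition = h.partition →
        x.coeff g = x.coeff h := by
      intro g h hgh
      obtain ⟨c, hc⟩ := isConj_iff.1 (Equiv.Perm.partition_eq_of_isConj.2 hgh)
      have h1 := congrArg (fun y => y.coeff (c * g)) (hx' (of ℂ _ c))
      simp only [GroupAlgebra.coeff_of_mul, GroupAlgebra.coeff_mul_of, hc] at h1
      simpa using h1
    classical
    -- The default 0 is never read: the function is only evaluated at cycle types.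
    refine ⟨fun ν => if h : ∃ g : Equiv.Perm (Fin n), g.partition = ν then x.coeff h.choose
      else 0, ?_⟩
    change ∑ g : Equiv.Perm (Fin n), _ • of ℂ _ g = x
    conv_rhs => rw [← GroupAlgebra.sum_coeff_smul_of x]
    refine Finset.sum_congr rfl fun g _ => ?_
    have hex : ∃ g' : Equiv.Perm (Fin n), g'.partition = g.partition := ⟨g, rfl⟩
    congr 1
    exact (dif_pos hex).trans (hconj _ _ hex.choose_spec)
  calc _ ≤ Module.finrank ℂ (LinearMap.range f) := Submodule.finrank_mono hle
    _ ≤ Module.finrank ℂ (((Fintype.card (Fin n)).Partition) → ℂ) := LinearMap.finrank_range_le f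
    _ = Fintype.card (Fintype.card (Fin n)).Partition := Module.finrank_fintype_fun_eq_card ℂ
    _ = _ := by rw [hn]

theorem sum_dimSpecht_sq (n : ℕ) : ∑ lam : n.Partition, dimSpecht lam ^ 2 = n.factorial := by
  have := GroupAlgebra.sum_idealDim_sq (e := primIdem (n := n)) primIdem_isSymmPrimitive
    (fun _ _ h => primIdem_mul_mul_primIdem h) (finrank_center_le n)
  simpa only [idealDim_primIdem, Fintype.card_perm, Fintype.card_fin] using this

theorem sum_dimSpecht (n : ℕ) : ∑ lam : n.Partition, dimSpecht lam =
    (Finset.univ.filter fun g : Equiv.Perm (Fin n) => g * g = 1).card := by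
  have := GroupAlgebra.sum_idealDim (e := primIdem (n := n)) primIdem_isSymmPrimitive
    (fun _ _ h => primIdem_mul_mul_primIdem h) (finrank_center_le n)
  simpa only [idealDim_primIdem] using this

theorem dimSpecht_le_maxDim (lam : n.Partition) : dimSpecht lam ≤ maxDim n := by
  refine (maxDim_isGreatest n).2 ?_
  let N := Submodule.span (MonoidAlgebra ℂ (Equiv.Perm (Fin n))) {primIdem lam}
  have hs : IsSimpleModule (MonoidAlgebra ℂ (Equiv.Perm (Fin n))) N :=
    (primIdem_isSymmPrimitive lam).isSimpleModule
  refine ⟨RestrictScalars ℂ (MonoidAlgebra ℂ (Equiv.Perm (Fin n))) N,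
    inferInstanceAs (AddCommGroup (RestrictScalars ℂ (MonoidAlgebra ℂ (Equiv.Perm (Fin n))) N)),
    RestrictScalars.module ℂ (MonoidAlgebra ℂ (Equiv.Perm (Fin n))) N,
    Representation.ofModule N,
    (Representation.isSimpleModule_iff_irreducible_ofModule N).1 hs, ?_⟩
  rw [← idealDim_primIdem]
  let φ : RestrictScalars ℂ (MonoidAlgebra ℂ (Equiv.Perm (Fin n))) N ≃ₗ[ℂ] N :=
    { RestrictScalars.addEquiv ℂ (MonoidAlgebra ℂ (Equiv.Perm (Fin n))) N with
      map_smul' := fun c x => by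
        change RestrictScalars.addEquiv ℂ (MonoidAlgebra ℂ (Equiv.Perm (Fin n))) N (c • x) = _
        rw [RestrictScalars.addEquiv_map_smul, algebraMap_smul]
        rfl }
  exact φ.finrank_eq

theorem exists_dimSpecht_eq_maxDim (n : ℕ) : ∃ lam : n.Partition, dimSpecht lam = maxDim n := by
  obtain ⟨V, _, _, ρ, hρ, hd⟩ := (maxDim_isGreatest n).1
  have hs := (Representation.irreducible_iff_isSimpleModule_asModule ρ).1 hρ
  obtain ⟨lam, h⟩ := GroupAlgebra.exists_finrank_le (e := primIdem (n := n))
    primIdem_isSymmPrimitive (fun _ _ h => primIdem_mul_mul_primIdem h) (finrank_center_le n)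
    ρ.asModule
  refine ⟨lam, le_antisymm (dimSpecht_le_maxDim lam) ?_⟩
  rw [← hd, ← ρ.asModuleEquiv.finrank_eq, ← idealDim_primIdem]
  exact h

end Symmetrizers

/-! ### Upper bound for the number of involutions. -/

section Involutions

/-- The number of solutions of `g * g = 1` in the symmetric group on `n` letters. -/
noncomputable def involutionCount (n : ℕ) : ℕ :=
  Nat.card {g : Equiv.Perm (Fin n) // g * g = 1}

theorem natCard_involutions {α : Type} [Finite α] {n : ℕ} (h : Nat.card α = n) :
    Nat.card {g : Equiv.Perm α // g * g = 1} = involutionCount n := by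
  let φ : α ≃ Fin n := Finite.equivFinOfCardEq h
  refine Nat.card_congr (φ.permCongrHom.toEquiv.subtypeEquiv fun g => ?_)
  change g * g = 1 ↔ φ.permCongrHom g * φ.permCongrHom g = 1
  rw [← map_mul, map_eq_one_iff _ φ.permCongrHom.injective]

theorem involution_apply_ne {α : Type} {g : Equiv.Perm α} (hg : g * g = 1) (a x : α) :
    (x ≠ a ∧ x ≠ g a) ↔ (g x ≠ a ∧ g x ≠ g a) := by
  have h1 : ∀ y, g (g y) = y := fun y => by rw [← Equiv.Perm.mul_apply, hg]; rfl
  have h2 : g x = a ↔ x = g a := ⟨fun h => by rw [← h, h1], fun h => by rw [h, h1]⟩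
  rw [Ne, Ne, Ne, Ne, h2, g.injective.eq_iff, and_comm]

/-- An involution is determined by the image of one point and its restriction to the others. -/
theorem natCard_involutions_le {α : Type} [Fintype α] (a : α) :
    Nat.card {g : Equiv.Perm α // g * g = 1} ≤
      ∑ b : α, Nat.card {g : Equiv.Perm {x : α // x ≠ a ∧ x ≠ b} // g * g = 1} := by
  rw [← Nat.card_sigma]
  let F : {g : Equiv.Perm α // g * g = 1} →
      Σ b : α, {g : Equiv.Perm {x : α // x ≠ a ∧ x ≠ b} // g * g = 1} := fun g =>
    ⟨g.1 a, g.1.subtypePerm fun x => (involution_apply_ne g.2 a x).symm, by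
      ext x
      have : (g.1 * g.1) x.1 = x.1 := by rw [g.2]; rfl
      exact this⟩
  refine Nat.card_le_card_of_injective F ?_
  have key : ∀ (b c : α) (g : {g : Equiv.Perm {x : α // x ≠ a ∧ x ≠ b} // g * g = 1})
      (h : {g : Equiv.Perm {x : α // x ≠ a ∧ x ≠ c} // g * g = 1}),
      (⟨b, g⟩ : Σ b : α, {g : Equiv.Perm {x : α // x ≠ a ∧ x ≠ b} // g * g = 1}) = ⟨c, h⟩ →
      b = c ∧ ∀ x (hb : x ≠ a ∧ x ≠ b) (hc : x ≠ a ∧ x ≠ c),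
        (g.1 ⟨x, hb⟩).1 = (h.1 ⟨x, hc⟩).1 := by
    intro b c g h heq
    cases heq
    exact ⟨rfl, fun _ _ _ => rfl⟩
  rintro ⟨g, hg⟩ ⟨h, hh⟩ hF
  obtain ⟨hab, hx⟩ := key _ _ _ _ hF
  have hab' : g a = h a := hab
  refine Subtype.ext (Equiv.ext fun x => ?_)
  by_cases hxa : x = a
  · rw [hxa]; exact hab
  · by_cases hxb : x = g a
    · have h1 : g (g a) = a := by rw [← Equiv.Perm.mul_apply, hg]; rfl
      have h2 : h (h a) = a := by rw [← Equiv.Perm.mul_apply, hh]; rfl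
      change g x = h x
      rw [hxb, h1, hab', h2]
    · exact hx x ⟨hxa, hxb⟩ ⟨hxa, by rw [← hab']; exact hxb⟩

/-- If 0 is fixed, n + 1 points remain; each of the n + 1 other images leaves n points. -/
theorem involutionCount_succ_succ_le (n : ℕ) :
    involutionCount (n + 2) ≤ involutionCount (n + 1) + (n + 1) * involutionCount n := by
  refine (natCard_involutions_le (0 : Fin (n + 2))).trans ?_
  rw [Fin.sum_univ_succ]
  refine add_le_add (le_of_eq ?_) ?_
  · refine natCard_involutions ?_
    simp only [and_self]
    rw [Nat.card_eq_fintype_card, Fintype.card_subtype_compl]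
    simp
  · rw [Finset.sum_congr rfl fun b _ => natCard_involutions (n := n) ?_]
    · simp
    · have : ∀ x : Fin (n + 2), (x ≠ 0 ∧ x ≠ Fin.succ b) ↔ x ∈ ({0, Fin.succ b}ᶜ : Finset _) := by
        intro x; simp
      rw [Nat.card_congr (Equiv.subtypeEquivRight this), Nat.card_eq_fintype_card,
        Fintype.card_coe, Finset.card_compl, Finset.card_pair (Fin.succ_ne_zero b).symm]
      simp

/-- The induction step for `involutionCount_le`, with x = n + 1 and √((n + 1)!) divided out. Both
sides are compared with (w + 1/2) e^v, using e^t ≥ 1 + t for the gaps v − u ≥ 1/(2v) and w − v ≥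
1/(2w). -/
theorem exp_sqrt_add_le {x : ℝ} (hx : 1 ≤ x) :
    Real.exp √x + √x * Real.exp √(x - 1) ≤ √(x + 1) * Real.exp √(x + 1) := by
  set u := √(x - 1)
  set v := √x
  set w := √(x + 1)
  have hu : u ^ 2 = x - 1 := Real.sq_sqrt (by linarith)
  have hv : v ^ 2 = x := Real.sq_sqrt (by linarith)
  have hw : w ^ 2 = x + 1 := Real.sq_sqrt (by linarith)
  have hu0 : 0 ≤ u := Real.sqrt_nonneg _
  have hv1 : 1 ≤ v := Real.one_le_sqrt.2 hx
  have huv : u ≤ v := Real.sqrt_le_sqrt (by linarith)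
  have hvw : v ≤ w := Real.sqrt_le_sqrt (by linarith)
  have hv0 := Real.exp_pos v
  have h1 : Real.exp v * (w - v + 1) ≤ Real.exp w := by
    have := Real.add_one_le_exp (w - v)
    calc _ ≤ Real.exp v * Real.exp (w - v) := by gcongr
      _ = _ := by rw [← Real.exp_add]; congr 1; ring
  have h2 : Real.exp u * (v - u + 1) ≤ Real.exp v := by
    have := Real.add_one_le_exp (v - u)
    calc _ ≤ Real.exp u * Real.exp (v - u) := by gcongr
      _ = _ := by rw [← Real.exp_add]; congr 1; ring
  have hb : 1 ≤ 2 * v * (v - u) := by nlinarith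
  have ha : 1 ≤ 2 * w * (w - v) := by nlinarith
  have h3 : v * Real.exp u * (2 * v + 1) ≤ 2 * v ^ 2 * Real.exp v := by
    have h4 : 2 * v + 1 ≤ 2 * v * (v - u + 1) := by linarith
    calc v * Real.exp u * (2 * v + 1) ≤ v * Real.exp u * (2 * v * (v - u + 1)) := by gcongr
      _ = 2 * v ^ 2 * (Real.exp u * (v - u + 1)) := by ring
      _ ≤ _ := by gcongr
  -- Gives w + v ≤ 4v + 2, hence `h5` from (w − v)(w + v) = 1; `h6` is `h5` rearranged.
  have hw3 : w ≤ 3 * v + 2 := by nlinarith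
  have h5 : 1 ≤ (w - v) * (4 * v + 2) := by
    have : (w - v) * (w + v) = 1 := by ring_nf; linarith
    nlinarith
  have h6 : (2 * v + 1) * (1 : ℝ) + 2 * v ^ 2 ≤ (w + 1 / 2) * (2 * v + 1) := by nlinarith
  have h7 : Real.exp v * (w + 1 / 2) ≤ w * Real.exp w := by
    calc Real.exp v * (w + 1 / 2) ≤ Real.exp v * (w * (w - v + 1)) := by
          gcongr; linarith
      _ = w * (Real.exp v * (w - v + 1)) := by ring
      _ ≤ _ := by gcongr
  refine le_trans ?_ h7
  refine le_of_mul_le_mul_right ?_ (show 0 < 2 * v + 1 by linarith)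
  calc (Real.exp v + v * Real.exp u) * (2 * v + 1)
      = Real.exp v * (2 * v + 1) + v * Real.exp u * (2 * v + 1) := by ring
    _ ≤ Real.exp v * (2 * v + 1) + 2 * v ^ 2 * Real.exp v := by gcongr
    _ = Real.exp v * ((2 * v + 1) * 1 + 2 * v ^ 2) := by ring
    _ ≤ Real.exp v * ((w + 1 / 2) * (2 * v + 1)) := by gcongr
    _ = _ := by ring

theorem involutionCount_le (n : ℕ) :
    (involutionCount n : ℝ) ≤ √(n.factorial) * Real.exp √n := by
  induction n using Nat.twoStepInduction with
  | zero =>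
    have : involutionCount 0 ≤ 1 := by
      rw [involutionCount]
      exact Finite.card_le_one_iff_subsingleton.2 inferInstance
    simpa using this
  | one =>
    have : involutionCount 1 ≤ 1 := by
      rw [involutionCount]
      exact Finite.card_le_one_iff_subsingleton.2 inferInstance
    have h1 : (involutionCount 1 : ℝ) ≤ 1 := by exact_mod_cast this
    simpa using h1.trans (Real.one_le_exp zero_le_one)
  | more n h0 h1 =>
    have hx : (1 : ℝ) ≤ (n : ℝ) + 1 := by linarith [Nat.cast_nonneg (α := ℝ) n]
    have key := exp_sqrt_add_le hx
    have hrec : (involutionCount (n + 2) : ℝ) ≤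
        involutionCount (n + 1) + (n + 1) * involutionCount n := by
      exact_mod_cast involutionCount_succ_succ_le n
    have hf1 : √((n + 1).factorial : ℝ) = √((n : ℝ) + 1) * √(n.factorial : ℝ) := by
      rw [Nat.factorial_succ, Nat.cast_mul, Real.sqrt_mul (by positivity)]
      push_cast; rfl
    have hf2 : √((n + 2).factorial : ℝ) = √((n : ℝ) + 1 + 1) * √((n + 1).factorial : ℝ) := by
      rw [Nat.factorial_succ, Nat.cast_mul, Real.sqrt_mul (by positivity)]
      push_cast; rfl
    have hs : √((n : ℝ) + 1) * √((n : ℝ) + 1) = n + 1 := Real.mul_self_sqrt (by linarith)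
    rw [add_sub_cancel_right] at key
    calc (involutionCount (n + 2) : ℝ)
        ≤ involutionCount (n + 1) + (n + 1) * involutionCount n := hrec
      _ ≤ √((n + 1).factorial : ℝ) * Real.exp √((n : ℝ) + 1) +
          (n + 1) * (√(n.factorial : ℝ) * Real.exp √n) := by
          push_cast at h1
          gcongr
      _ = √((n + 1).factorial : ℝ) *
          (Real.exp √((n : ℝ) + 1) + √((n : ℝ) + 1) * Real.exp √n) := by
          rw [hf1]
          linear_combination (-(√(n.factorial : ℝ) * Real.exp √n)) * hs
      _ ≤ √((n + 1).factorial : ℝ) * (√((n : ℝ) + 1 + 1) * Real.exp √((n : ℝ) + 1 + 1)) := by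
          gcongr
      _ = _ := by
          rw [hf2]; push_cast
          rw [show (n : ℝ) + 1 + 1 = n + 2 by ring]; ring

end Involutions

/-! ### Lower bound for the number of partitions. -/

section PartitionBound

/-- The tuples of `d` natural numbers with sum at most `X`. -/
def tuplesSumLe (d X : ℕ) : Finset (Fin d → ℕ) :=
  (Fintype.piFinset fun _ => Finset.range (X + 1)).filter fun f => ∑ i, f i ≤ X

theorem mem_tuplesSumLe {d X : ℕ} {f : Fin d → ℕ} : f ∈ tuplesSumLe d X ↔ ∑ i, f i ≤ X := by
  simp only [tuplesSumLe, Finset.mem_filter, Fintype.mem_piFinset, Finset.mem_range,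
    and_iff_right_iff_imp]
  intro h i
  exact Nat.lt_succ_of_le ((Finset.single_le_sum (fun _ _ => Nat.zero_le _)
    (Finset.mem_univ i)).trans h)

/-- A slack coordinate makes the sum exactly X, so stars and bars supplies C(X + d, d) tuples, and
d! C(X + d, d) ≥ X^d. -/
theorem pow_le_card_tuplesSumLe (d X : ℕ) : X ^ d ≤ d.factorial * (tuplesSumLe d X).card := by
  classical
  have h1 : (X + d).choose d ≤ (tuplesSumLe d X).card := by
    have hc := Finset.card_finsuppAntidiag_nat_eq_choose
      (s := (Finset.univ : Finset (Fin (d + 1)))) X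
    rw [Finset.card_univ, Fintype.card_fin, show d + 1 + X - 1 = X + d by omega,
      Nat.choose_symm_add] at hc
    rw [← hc]
    refine Finset.card_le_card_of_injOn (fun f i => f i.succ) (fun f hf => ?_)
      fun f hf g hg hfg => ?_
    · have h2 := (Finset.mem_finsuppAntidiag.1 hf).1
      rw [Fin.sum_univ_succ] at h2
      exact mem_tuplesSumLe.2 (show ∑ i : Fin d, f i.succ ≤ X by omega)
    · have h2 := (Finset.mem_finsuppAntidiag.1 hf).1
      have h3 := (Finset.mem_finsuppAntidiag.1 hg).1
      rw [Fin.sum_univ_succ] at h2 h3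
      have h4 : ∀ i : Fin d, f i.succ = g i.succ := fun i => congrFun hfg i
      rw [Finset.sum_congr rfl fun i _ => h4 i] at h2
      refine Finsupp.ext fun i => ?_
      refine Fin.cases ?_ h4 i
      omega
  calc X ^ d ≤ (X + 1) ^ d := Nat.pow_le_pow_left (Nat.le_succ X) d
    _ = (X + d + 1 - d) ^ d := by congr 1; omega
    _ ≤ (X + d).descFactorial d := Nat.pow_sub_le_descFactorial _ d
    _ = d.factorial * (X + d).choose d := Nat.descFactorial_eq_factorial_mul_choose _ d
    _ ≤ _ := Nat.mul_le_mul_left _ h1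

/-- The multisets of `d` natural numbers with sum at most `X`. -/
def multisetsSumLe (d X : ℕ) : Finset (Multiset ℕ) :=
  (tuplesSumLe d X).image fun f => (List.ofFn f : Multiset ℕ)

/-- At most d! tuples give the same multiset. -/
theorem pow_le_card_multisetsSumLe (d X : ℕ) :
    X ^ d ≤ d.factorial ^ 2 * (multisetsSumLe d X).card := by
  have h1 : (tuplesSumLe d X).card ≤ d.factorial * (multisetsSumLe d X).card := by
    refine Finset.card_le_mul_card_image _ _ fun M hM => ?_
    obtain ⟨f₀, -, rfl⟩ := Finset.mem_image.1 hM
    have h2 : ((List.ofFn f₀).permutations.toFinset).card ≤ d.factorial := by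
      refine (List.toFinset_card_le _).trans ?_
      rw [List.length_permutations, List.length_ofFn]
    refine le_trans ?_ h2
    refine Finset.card_le_card_of_injOn (fun f => List.ofFn f) (fun f hf => ?_)
      fun f _ g _ hfg => List.ofFn_injective hfg
    have h3 := (Finset.mem_filter.1 hf).2
    simpa [List.mem_permutations] using h3
  calc X ^ d ≤ d.factorial * (tuplesSumLe d X).card := pow_le_card_tuplesSumLe d X
    _ ≤ d.factorial * (d.factorial * (multisetsSumLe d X).card) := Nat.mul_le_mul_left _ h1
    _ = _ := by ring

/-- The multiplicity functions of the parts `2, …, d + 1` which arise by rounding down the tuples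
with sum at most `X`. -/
def multiplicitiesSumLe (d X : ℕ) : Finset (Fin d → ℕ) :=
  (tuplesSumLe d X).image fun f i => f i / (i + 2)

theorem prod_add_two_eq_factorial (d : ℕ) : ∏ i : Fin d, ((i : ℕ) + 2) = (d + 1).factorial := by
  induction d with
  | zero => simp
  | succ d ih =>
    rw [Fin.prod_univ_castSucc, Nat.factorial_succ (d + 1), ← ih, mul_comm]
    simp

/-- Each fibre of the rounding lies in a box with sides 2, …, d + 1, which has (d + 1)! points. -/
theorem pow_le_card_multiplicitiesSumLe (d X : ℕ) :
    X ^ d ≤ d.factorial * (d + 1).factorial * (multiplicitiesSumLe d X).card := by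
  have h1 : (tuplesSumLe d X).card ≤ (d + 1).factorial * (multiplicitiesSumLe d X).card := by
    refine Finset.card_le_mul_card_image _ _ fun m hm => ?_
    have h2 : (Fintype.piFinset fun i : Fin d =>
        Finset.Ico (((i : ℕ) + 2) * m i) (((i : ℕ) + 2) * m i + (i + 2))).card =
        (d + 1).factorial := by
      rw [Fintype.card_piFinset, ← prod_add_two_eq_factorial]
      simp
    rw [← h2]
    refine Finset.card_le_card fun f hf => ?_
    have h3 := (Finset.mem_filter.1 hf).2
    rw [Fintype.mem_piFinset]
    intro i
    rw [← congrFun h3 i, Finset.mem_Ico]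
    have h4 := Nat.div_add_mod (f i) ((i : ℕ) + 2)
    have h5 := Nat.mod_lt (f i) (show 0 < (i : ℕ) + 2 by omega)
    omega
  calc X ^ d ≤ d.factorial * (tuplesSumLe d X).card := pow_le_card_tuplesSumLe d X
    _ ≤ d.factorial * ((d + 1).factorial * (multiplicitiesSumLe d X).card) :=
        Nat.mul_le_mul_left _ h1
    _ = _ := by ring

theorem card_of_mem_multisetsSumLe {d X : ℕ} {M : Multiset ℕ} (hM : M ∈ multisetsSumLe d X) :
    M.card = d ∧ M.sum ≤ X := by
  obtain ⟨f, hf, rfl⟩ := Finset.mem_image.1 hM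
  refine ⟨by simp, ?_⟩
  rw [Multiset.sum_coe, List.sum_ofFn]
  exact mem_tuplesSumLe.1 hf

theorem sum_of_mem_multiplicitiesSumLe {d X : ℕ} {m : Fin d → ℕ}
    (hm : m ∈ multiplicitiesSumLe d X) : ∑ i, m i * ((i : ℕ) + 2) ≤ X := by
  obtain ⟨f, hf, rfl⟩ := Finset.mem_image.1 hm
  exact (Finset.sum_le_sum fun i _ => Nat.div_mul_le_self _ _).trans (mem_tuplesSumLe.1 hf)

/-- The multiset with parts `x + d + 2` for `x` in `M`, with `m i` parts equal to `i + 2`, and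
with `r` ones. -/
def assembleParts {d : ℕ} (M : Multiset ℕ) (m : Fin d → ℕ) (r : ℕ) : Multiset ℕ :=
  M.map (fun x => x + (d + 2)) + ∑ i, Multiset.replicate (m i) ((i : ℕ) + 2) +
    Multiset.replicate r 1

theorem sum_assembleParts {d : ℕ} (M : Multiset ℕ) (m : Fin d → ℕ) (r : ℕ) :
    (assembleParts M m r).sum =
      M.sum + M.card * (d + 2) + ∑ i, m i * ((i : ℕ) + 2) + r := by
  simp [assembleParts, Multiset.sum_add, Multiset.sum_map_add, Multiset.sum_sum]

theorem pos_of_mem_assembleParts {d : ℕ} {M : Multiset ℕ} {m : Fin d → ℕ} {r x : ℕ}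
    (hx : x ∈ assembleParts M m r) : 0 < x := by
  rw [assembleParts, Multiset.mem_add, Multiset.mem_add, Multiset.mem_map,
    Multiset.mem_sum] at hx
  rcases hx with (⟨y, -, rfl⟩ | ⟨i, -, h⟩) | h
  · omega
  · have := Multiset.eq_of_mem_replicate h
    omega
  · have := Multiset.eq_of_mem_replicate h
    omega

theorem filter_assembleParts {d : ℕ} (M : Multiset ℕ) (m : Fin d → ℕ) (r : ℕ) :
    (assembleParts M m r).filter (d + 2 ≤ ·) = M.map (fun x => x + (d + 2)) := by
  rw [assembleParts, Multiset.filter_add, Multiset.filter_add, Multiset.filter_eq_self.2,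
    Multiset.filter_eq_nil.2, Multiset.filter_eq_nil.2]
  · simp
  · intro x hx
    have := Multiset.eq_of_mem_replicate hx
    omega
  · intro x hx
    obtain ⟨i, -, h⟩ := Multiset.mem_sum.1 hx
    have := Multiset.eq_of_mem_replicate h
    omega
  · intro x hx
    obtain ⟨y, -, rfl⟩ := Multiset.mem_map.1 hx
    omega

theorem count_assembleParts {d : ℕ} (M : Multiset ℕ) (m : Fin d → ℕ) (r : ℕ) (j : Fin d) :
    (assembleParts M m r).count ((j : ℕ) + 2) = m j := by
  rw [assembleParts, Multiset.count_add, Multiset.count_add, Multiset.count_eq_zero.2,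
    Multiset.count_replicate, Multiset.count_sum', Finset.sum_eq_single j]
  · simp
  · intro i _ hij
    rw [Multiset.count_replicate, if_neg]
    intro h
    exact hij (Fin.ext (by omega))
  · simp
  · intro h
    obtain ⟨y, -, h⟩ := Multiset.mem_map.1 h
    omega

/-- Large parts are shifted by d + 2, so they recover M; the counts of 2, …, d + 1 recover m; ones
fill up to n. The shift costs d(d + 2). -/
theorem card_mul_card_le_card_partition {n d X Y : ℕ} (h : X + d * (d + 2) + Y ≤ n) :
    (multisetsSumLe d X).card * (multiplicitiesSumLe d Y).card ≤ Fintype.card n.Partition := by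
  rw [← Finset.card_product, ← Fintype.card_coe]
  have hsum : ∀ z : {z // z ∈ multisetsSumLe d X ×ˢ multiplicitiesSumLe d Y},
      (assembleParts z.1.1 z.1.2
        (n - (z.1.1.sum + z.1.1.card * (d + 2) + ∑ i, z.1.2 i * ((i : ℕ) + 2)))).sum = n := by
    intro z
    obtain ⟨h1, h2⟩ := Finset.mem_product.1 z.2
    obtain ⟨h3, h4⟩ := card_of_mem_multisetsSumLe h1
    have h5 := sum_of_mem_multiplicitiesSumLe h2
    rw [sum_assembleParts, h3]
    omega
  let F : {z // z ∈ multisetsSumLe d X ×ˢ multiplicitiesSumLe d Y} → n.Partition := fun z =>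
    ⟨_, pos_of_mem_assembleParts, hsum z⟩
  refine Fintype.card_le_of_injective F fun z w hzw => ?_
  have hp := congrArg Nat.Partition.parts hzw
  refine Subtype.ext (Prod.ext ?_ (funext fun j => ?_))
  · have := congrArg (Multiset.filter (d + 2 ≤ ·)) hp
    rw [filter_assembleParts, filter_assembleParts] at this
    exact Multiset.map_injective (fun x y h => by simpa using h) this
  · have := congrArg (Multiset.count ((j : ℕ) + 2)) hp
    rwa [count_assembleParts, count_assembleParts] at this

/-- A lower bound for the number of partitions. -/
theorem two_pow_mul_pow_le_card_partition {n d : ℕ} (h : 4 * d ^ 2 + 2 * d ≤ n) :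
    2 ^ d * d ^ (4 * d) ≤ d.factorial ^ 4 * (d + 1) * Fintype.card n.Partition := by
  -- The budgets d² and 2d² with the shift d² + 2d use exactly 4d² + 2d, and the factor 2 in the
  -- second yields 2^d.
  have h1 := pow_le_card_multisetsSumLe d (d ^ 2)
  have h2 := pow_le_card_multiplicitiesSumLe d (2 * d ^ 2)
  have h3 : (multisetsSumLe d (d ^ 2)).card * (multiplicitiesSumLe d (2 * d ^ 2)).card ≤
      Fintype.card n.Partition := card_mul_card_le_card_partition (by nlinarith)
  calc 2 ^ d * d ^ (4 * d) = (d ^ 2) ^ d * (2 * d ^ 2) ^ d := by ring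
    _ ≤ (d.factorial ^ 2 * (multisetsSumLe d (d ^ 2)).card) *
        (d.factorial * (d + 1).factorial * (multiplicitiesSumLe d (2 * d ^ 2)).card) :=
        Nat.mul_le_mul h1 h2
    _ = d.factorial ^ 4 * (d + 1) *
        ((multisetsSumLe d (d ^ 2)).card * (multiplicitiesSumLe d (2 * d ^ 2)).card) := by
        rw [Nat.factorial_succ]; ring
    _ ≤ _ := Nat.mul_le_mul_left _ h3

/-- A weak Stirling bound. The induction needs e ≤ (1 + 1/d)^(d+1), which follows from 1 − 1/(d + 1)
≤ e^{−1/(d+1)}. -/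
theorem factorial_mul_exp_le {d : ℕ} (hd : 1 ≤ d) :
    (d.factorial : ℝ) * Real.exp d ≤ Real.exp 1 * d ^ (d + 1) := by
  induction d, hd using Nat.le_induction with
  | base => simp
  | succ d hd ih =>
    have hd0 : (0 : ℝ) < d := by exact_mod_cast hd
    have key : Real.exp 1 * (d : ℝ) ^ (d + 1) ≤ ((d : ℝ) + 1) ^ (d + 1) := by
      have h1 : Real.exp (1 / ((d : ℝ) + 1)) ≤ ((d : ℝ) + 1) / d := by
        have h2 := Real.add_one_le_exp (-(1 / ((d : ℝ) + 1)))
        rw [Real.exp_neg] at h2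
        have h3 : -(1 / ((d : ℝ) + 1)) + 1 = (((d : ℝ) + 1) / d)⁻¹ := by field_simp; ring
        rw [h3] at h2
        exact (inv_le_inv₀ (by positivity) (Real.exp_pos _)).1 h2
      have h4 : Real.exp 1 ≤ (((d : ℝ) + 1) / d) ^ (d + 1) := by
        calc Real.exp 1 = Real.exp (1 / ((d : ℝ) + 1)) ^ (d + 1) := by
              rw [← Real.exp_nat_mul]; congr 1; push_cast; field_simp
          _ ≤ _ := by gcongr
      rw [div_pow, le_div_iff₀ (by positivity)] at h4
      exact h4
    rw [Nat.factorial_succ]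
    push_cast
    rw [Real.exp_add]
    calc ((d : ℝ) + 1) * d.factorial * (Real.exp d * Real.exp 1)
        = (d + 1) * Real.exp 1 * (d.factorial * Real.exp d) := by ring
      _ ≤ (d + 1) * Real.exp 1 * (Real.exp 1 * d ^ (d + 1)) := by gcongr
      _ ≤ (d + 1) * Real.exp 1 * ((d : ℝ) + 1) ^ (d + 1) := by gcongr
      _ = _ := by ring

theorem two_pow_mul_exp_le_card_partition {n d : ℕ} (hd : 1 ≤ d) (h : 4 * d ^ 2 + 2 * d ≤ n) :
    2 ^ d * Real.exp (4 * d) ≤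
      Real.exp 4 * ((d : ℝ) ^ 4 * (d + 1)) * Fintype.card n.Partition := by
  have hd0 : (0 : ℝ) < d := by exact_mod_cast hd
  have h1 : (2 : ℝ) ^ d * (d : ℝ) ^ (4 * d) ≤
      (d.factorial : ℝ) ^ 4 * (d + 1) * Fintype.card n.Partition := by
    exact_mod_cast two_pow_mul_pow_le_card_partition h
  have h2 : ((d.factorial : ℝ) * Real.exp d) ^ 4 ≤ (Real.exp 1 * (d : ℝ) ^ (d + 1)) ^ 4 :=
    pow_le_pow_left₀ (by positivity) (factorial_mul_exp_le hd) 4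
  have h3 : Real.exp d ^ 4 = Real.exp (4 * d) := by rw [← Real.exp_nat_mul]; norm_num
  have h4 : Real.exp 1 ^ 4 = Real.exp 4 := by rw [← Real.exp_nat_mul]; norm_num
  rw [mul_pow, mul_pow, h3, h4] at h2
  refine le_of_mul_le_mul_right ?_ (show (0 : ℝ) < (d : ℝ) ^ (4 * d) by positivity)
  calc (2 : ℝ) ^ d * Real.exp (4 * d) * (d : ℝ) ^ (4 * d)
      = Real.exp (4 * d) * ((2 : ℝ) ^ d * (d : ℝ) ^ (4 * d)) := by ring
    _ ≤ Real.exp (4 * d) * ((d.factorial : ℝ) ^ 4 * (d + 1) * Fintype.card n.Partition) := by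
        gcongr
    _ = ((d.factorial : ℝ) ^ 4 * Real.exp (4 * d)) * ((d + 1) * Fintype.card n.Partition) := by
        ring
    _ ≤ (Real.exp 4 * ((d : ℝ) ^ (d + 1)) ^ 4) * ((d + 1) * Fintype.card n.Partition) := by
        gcongr
    _ = _ := by ring

end PartitionBound

/-! ### The proportion and its limit. -/

section Proportion

theorem card_partition_pos (n : ℕ) : 0 < Fintype.card n.Partition :=
  Fintype.card_pos

theorem proportion_pos {A : ℝ} (hA1 : A < 1) (n : ℕ) : 0 < proportion A n := by
  obtain ⟨lam, h⟩ := exists_dimSpecht_eq_maxDim n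
  refine div_pos ?_ (by exact_mod_cast card_partition_pos n)
  have : Nonempty {lam : n.Partition //
      A * (maxDim n : ℝ) ≤ (dimSpecht lam : ℝ) ∧ dimSpecht lam ≤ maxDim n} := by
    refine ⟨lam, ?_, h.le⟩
    rw [h]
    exact mul_le_of_le_one_left (Nat.cast_nonneg _) hA1.le
  exact_mod_cast Nat.card_pos

theorem proportion_le_one (A : ℝ) (n : ℕ) : proportion A n ≤ 1 := by
  refine div_le_one_of_le₀ ?_ (Nat.cast_nonneg _)
  rw [← Nat.card_eq_fintype_card]
  exact_mod_cast Nat.card_le_card_of_injective _ Subtype.val_injective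

/-- Σ d_λ² ≤ m_n Σ d_λ. -/
theorem factorial_le_maxDim_mul (n : ℕ) : n.factorial ≤ maxDim n * involutionCount n := by
  have h1 : involutionCount n = ∑ lam : n.Partition, dimSpecht lam := by
    rw [sum_dimSpecht, involutionCount, Nat.card_eq_fintype_card, Fintype.card_subtype]
  rw [h1, ← sum_dimSpecht_sq, Finset.mul_sum]
  refine Finset.sum_le_sum fun lam _ => ?_
  rw [pow_two]
  exact Nat.mul_le_mul_right _ (dimSpecht_le_maxDim lam)

/-- A Chebyshev count: N partitions with d_λ ≥ A m_n give N (A m_n)² ≤ n!, and m_n² ≥ n! e^{−2√n}.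
-/
theorem proportion_mul_le {A : ℝ} (hA0 : 0 < A) (n : ℕ) :
    A ^ 2 * (proportion A n * Fintype.card n.Partition) ≤ Real.exp (2 * √n) := by
  classical
  set S := (Finset.univ : Finset n.Partition).filter fun lam =>
    A * (maxDim n : ℝ) ≤ (dimSpecht lam : ℝ) ∧ dimSpecht lam ≤ maxDim n with hS
  have hp : proportion A n * Fintype.card n.Partition = S.card := by
    have : (Fintype.card n.Partition : ℝ) ≠ 0 := by exact_mod_cast (card_partition_pos n).ne'
    rw [proportion, div_mul_cancel₀ _ this, Nat.card_eq_fintype_card, Fintype.card_subtype]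
  have h1 : (S.card : ℝ) * (A * maxDim n) ^ 2 ≤ n.factorial := by
    rw [← sum_dimSpecht_sq]
    push_cast
    calc (S.card : ℝ) * (A * maxDim n) ^ 2 = ∑ _lam ∈ S, (A * maxDim n) ^ 2 := by
          rw [Finset.sum_const, nsmul_eq_mul]
      _ ≤ ∑ lam ∈ S, (dimSpecht lam : ℝ) ^ 2 := by
          refine Finset.sum_le_sum fun lam hlam => ?_
          exact pow_le_pow_left₀ (by positivity) (Finset.mem_filter.1 hlam).2.1 2
      _ ≤ _ := Finset.sum_le_sum_of_subset_of_nonneg (Finset.subset_univ _)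
          fun _ _ _ => by positivity
  have h2 : (n.factorial : ℝ) ≤ maxDim n * (√(n.factorial) * Real.exp √n) := by
    calc (n.factorial : ℝ) ≤ maxDim n * involutionCount n := by
          exact_mod_cast factorial_le_maxDim_mul n
      _ ≤ _ := by gcongr; exact involutionCount_le n
  have hf : (0 : ℝ) < n.factorial := by exact_mod_cast n.factorial_pos
  have h3 : (n.factorial : ℝ) ^ 2 ≤ (maxDim n : ℝ) ^ 2 * (n.factorial * Real.exp (2 * √n)) := by
    calc (n.factorial : ℝ) ^ 2 ≤ (maxDim n * (√(n.factorial) * Real.exp √n)) ^ 2 :=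
          pow_le_pow_left₀ hf.le h2 2
      _ = (maxDim n : ℝ) ^ 2 * (√(n.factorial) ^ 2 * Real.exp √n ^ 2) := by ring
      _ = _ := by
          rw [Real.sq_sqrt hf.le, ← Real.exp_nat_mul]
          norm_num
  rw [hp]
  refine le_of_mul_le_mul_right ?_ (show (0 : ℝ) < (n.factorial : ℝ) ^ 2 by positivity)
  calc A ^ 2 * (S.card : ℝ) * (n.factorial : ℝ) ^ 2
      ≤ A ^ 2 * (S.card : ℝ) * ((maxDim n : ℝ) ^ 2 * (n.factorial * Real.exp (2 * √n))) := by
        gcongr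
    _ = (S.card * (A * maxDim n) ^ 2) * (n.factorial * Real.exp (2 * √n)) := by ring
    _ ≤ n.factorial * (n.factorial * Real.exp (2 * √n)) := by gcongr
    _ = _ := by ring

/-- In e^10, e^6 comes from 2√n ≤ 4d + 6 and e^4 from the Stirling bound; the factors e^{4d} cancel.
-/
theorem proportion_le {A : ℝ} (hA0 : 0 < A) {n d : ℕ} (hd : 1 ≤ d)
    (h1 : 4 * d ^ 2 + 2 * d ≤ n) (h2 : n ≤ (2 * d + 3) ^ 2) :
    proportion A n ≤ Real.exp 10 / A ^ 2 * ((d : ℝ) ^ 4 * (d + 1) / 2 ^ d) := by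
  have hlow := two_pow_mul_exp_le_card_partition hd h1
  have hup := proportion_mul_le hA0 n
  have hp : (0 : ℝ) < Fintype.card n.Partition := by exact_mod_cast card_partition_pos n
  have hsqrt : √(n : ℝ) ≤ 2 * d + 3 := by
    rw [Real.sqrt_le_left (by positivity)]
    exact_mod_cast h2
  have hexp : Real.exp (2 * √n) ≤ Real.exp (4 * d) * Real.exp 6 := by
    rw [← Real.exp_add]
    exact Real.exp_le_exp.2 (by linarith)
  rw [div_mul_div_comm, le_div_iff₀ (by positivity)]
  refine le_of_mul_le_mul_right ?_ hp
  calc proportion A n * (A ^ 2 * 2 ^ d) * Fintype.card n.Partition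
      = A ^ 2 * (proportion A n * Fintype.card n.Partition) * 2 ^ d := by ring
    _ ≤ (Real.exp (4 * d) * Real.exp 6) * 2 ^ d :=
        mul_le_mul_of_nonneg_right (hup.trans hexp) (by positivity)
    _ = Real.exp 6 * (2 ^ d * Real.exp (4 * d)) := by ring
    _ ≤ Real.exp 6 * (Real.exp 4 * ((d : ℝ) ^ 4 * (d + 1)) * Fintype.card n.Partition) := by
        gcongr
    _ = _ := by
        rw [show (10 : ℝ) = 6 + 4 by norm_num, Real.exp_add]; ring

theorem tendsto_pow_mul_div_two_pow :
    Tendsto (fun d : ℕ => (d : ℝ) ^ 4 * (d + 1) / 2 ^ d) atTop (𝓝 0) := by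
  have h5 := tendsto_pow_const_div_const_pow_of_one_lt 5 (one_lt_two (α := ℝ))
  have h4 := tendsto_pow_const_div_const_pow_of_one_lt 4 (one_lt_two (α := ℝ))
  have := h5.add h4
  rw [add_zero] at this
  refine this.congr fun d => ?_
  ring

theorem tendsto_proportion {A : ℝ} (hA0 : 0 < A) (hA1 : A < 1) :
    Tendsto (fun n : ℕ => proportion A n) atTop (𝓝 0) := by
  -- Chosen so that 2d + 1 ≤ ⌊√n⌋ ≤ 2d + 2, whence 4d² + 2d ≤ n < (2d + 3)². Truncated subtraction
  -- is harmless since only d ≥ 1 is used.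
  let d : ℕ → ℕ := fun n => (Nat.sqrt n - 1) / 2
  have hsqrt : Tendsto Nat.sqrt atTop atTop :=
    tendsto_atTop_atTop.2 fun b => ⟨b * b, fun n hn => Nat.le_sqrt.2 hn⟩
  have hd : Tendsto d atTop atTop := by
    refine tendsto_atTop_atTop.2 fun b => ?_
    obtain ⟨N, hN⟩ := tendsto_atTop_atTop.1 hsqrt (2 * b + 1)
    refine ⟨N, fun n hn => ?_⟩
    have := hN n hn
    simp only [d]
    omega
  have hlim := ((tendsto_pow_mul_div_two_pow.comp hd).const_mul (Real.exp 10 / A ^ 2))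
  rw [mul_zero] at hlim
  refine tendsto_of_tendsto_of_tendsto_of_le_of_le' tendsto_const_nhds hlim
    (Eventually.of_forall fun n => (proportion_pos hA1 n).le) ?_
  filter_upwards [hd.eventually_ge_atTop 1] with n hn
  have h1 : 2 * d n + 1 ≤ Nat.sqrt n := by simp only [d] at hn ⊢; omega
  have h2 : Nat.sqrt n ≤ 2 * d n + 2 := by simp only [d] at hn ⊢; omega
  refine proportion_le hA0 hn ?_ ?_
  · have h3 := Nat.sqrt_le' n
    have h4 := Nat.pow_le_pow_left h1 2
    nlinarith
  · have h3 := Nat.lt_succ_sqrt' n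
    have h4 : (Nat.sqrt n).succ ^ 2 ≤ (2 * d n + 3) ^ 2 := Nat.pow_le_pow_left (by omega) 2
    omega

end Proportion

end SymGroupDim

theorem mainTheorem7 (A : ℝ) (hA0 : 0 < A) (hA1 : A < 1) :
    (∀ n : ℕ, 0 < SymGroupDim.proportion A n ∧ SymGroupDim.proportion A n ≤ 1) ∧
      Tendsto (fun n : ℕ => SymGroupDim.proportion A n) atTop (𝓝 0) :=
  ⟨fun n => ⟨SymGroupDim.proportion_pos hA1 n, SymGroupDim.proportion_le_one A n⟩,
    SymGroupDim.tendsto_proportion hA0 hA1⟩
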